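/- **Model.** For $n\ge 1$ and $\mu\in\mathbb N$, the uniform attachment graph $G_{ua}(n,\mu)$ is the random multigraph on vertices $v_1,\dots,v_n$ in which each $v_i$, $i\ge 2$, upon arrival chooses $\mu$ vertices from $v_1,\dots,v_{i-1}$ independently and uniformly at random (with repetition) and is joined to each of them by an edge. The graph is presented to the algorithm with its vertices relabelled by $1,\dots,n$ in an arbitrary way and with adjacency lists in an arbitrary order, so that the order of arrival is not available to it. Degrees $d_v$ count multiplicities, and the parallel edges between $u$ and $v$ are written $(u,v,1),(u,v,2),\dots$. An algorithm has probe access to $G$ through $\mathrm{Exists}(u,v)$, $\mathrm{Deg}(v)$ and $\mathrm{Nbr}(v,j)$, where $\mathrm{Nbr}(v,j)$ is the $j$-th entry of the adjacency list of $v$, or $\bot$ if there is none or if it repeats an earlier entry. A query is an edge $(u,v,i)$ of $G$; the algorithm knows the query, $n$, $\mu$ and the (integer part of the) threshold $$D:=\mu\,(H_{n-1}-H_6)+\mu/2 ,\qquad H_k=\sum_{j=1}^k \tfrac1j ,$$ keeps no memory between queries, and answers yes or no. Its running time is the number of elementary steps (register assignments, additions, subtractions, comparisons, probes). For a multigraph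 $G$ let $H(G)$ consist of the edges $(u,v,1)$ such that $d_u>D$ and $d_v>D$, or $v$ is the highest-degree neighbour of $u$, or $u$ is the highest-degree neighbour of $v$ (ties between neighbours being broken by the smaller label). A set $H$ of edges of $G$ is a $k$-spanner if $\mathrm{dist}_H(u,v)\le k\,\mathrm{dist}_G(u,v)$ for all $u,v$ connected in $G$. **Theorem.** There are absolute constants $c_\mu, C>0$ and $c\in\mathbb N$ and one deterministic algorithm such that for all $n\ge 1$ and all $\mu>c_\mu\log^2 n$ the following holds for $G\leftarrow G_{ua}(n,\mu)$, for every presentation of $G$ as above. 1. For every outcome of $G$ and every query $(u,v,i)$ the algorithm halts. Its running time is at most $C$ if $\min\{d_u,d_v\}>D$; it is always at most $C(d_u+d_v)$, and in the worst case at most $C\mu\log n$. 2. The expectation, over $G$, of the mean running time over all queries is at most $C\mu$. 3. With probability at least $1-1/n$ over $G$, all of the following hold: the algorithm answers every query $(u,v,i)$ according to whether $(u,v,i)\in H(G)$; $H(G)$ is a $(C\log n)$-spanner of $G$; $H(G)$ has at most $n+c$ edges; $d_u+d_v\le C\mu\log n$ for every query; and the mean of $d_u+d_v$ over all queries is at most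 $C\mu$. -/

import Mathlib

open MeasureTheory

/-! ### Multigraphs given by adjacency lists -/

/-- A multigraph on the vertex set `Fin n`, as its adjacency lists: `G v` lists the other ends of
the edges at `v`, in an arbitrary order and with multiplicity. -/
abbrev AdjLists (n : ℕ) : Type := Fin n → List (Fin n)

namespace AdjLists

variable {n : ℕ}

/-- The degree of `v`, counted with multiplicity. -/
def deg (G : AdjLists n) (v : Fin n) : ℕ := (G v).length

/-- The multiplicity of the edge between `u` and `v`. -/
def mult (G : AdjLists n) (u v : Fin n) : ℕ := (G u).count v

/-- The edges of `G`: the parallel edges between `u` and `v` are `(s(u, v), 1)`, …,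
`(s(u, v), mult u v)`. -/
def edges (G : AdjLists n) : Set (Sym2 (Fin n) × ℕ) :=
  {e | ∃ u v : Fin n, e.1 = s(u, v) ∧ 1 ≤ e.2 ∧ e.2 ≤ G.mult u v}

/-- The simple graph that underlies a set of edges. -/
def underlying (H : Set (Sym2 (Fin n) × ℕ)) : SimpleGraph (Fin n) where
  Adj u v := u ≠ v ∧ ∃ i, (s(u, v), i) ∈ H
  symm := ⟨fun u v h => ⟨h.1.symm, by simpa [Sym2.eq_swap] using h.2⟩⟩
  loopless := ⟨fun _ h => h.1 rfl⟩

/-- `H` is a `k`-spanner of `G`: a set of edges of `G` that preserves all (finite) distances of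
`G` up to the factor `k`. -/
def IsSpanner (G : AdjLists n) (H : Set (Sym2 (Fin n) × ℕ)) (k : ℝ) : Prop :=
  H ⊆ G.edges ∧ ∀ u v : Fin n, (underlying G.edges).Reachable u v →
    (underlying H).Reachable u v ∧
      ((underlying H).dist u v : ℝ) ≤ k * ((underlying G.edges).dist u v : ℝ)

/-- The admissible queries: the edges `(u, v, i)` of `G`, with both orientations. The index
`i = 1, …, mult u v` is stored as an element of `Fin (mult u v)`, shifted by one. -/
abbrev Query (G : AdjLists n) : Type := (u : Fin n) × (v : Fin n) × Fin (G.mult u v)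

/-- The edge that a query asks about. -/
def Query.edge {G : AdjLists n} (q : G.Query) : Sym2 (Fin n) × ℕ :=
  (s(q.1, q.2.1), (q.2.2 : ℕ) + 1)

/-- The sum `d_u + d_v` for a query `(u, v, i)`. -/
def Query.degSum {G : AdjLists n} (q : G.Query) : ℕ := G.deg q.1 + G.deg q.2.1

/-- The mean of `f` over all admissible queries (`0` if there are none). -/
noncomputable def queryMean (G : AdjLists n) (f : G.Query → ℕ) : ℝ :=
  (∑ q : G.Query, (f q : ℝ)) / (Fintype.card G.Query : ℝ)

/-- `v` is the highest-degree neighbour of `u`; ties go to the smaller label. -/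
def IsTopNeighbour (G : AdjLists n) (u v : Fin n) : Prop :=
  v ∈ G u ∧ ∀ w ∈ G u, G.deg w < G.deg v ∨ (G.deg w = G.deg v ∧ v ≤ w)

/-- The edges that are kept with the threshold `D`: the first edge between two adjacent vertices
`u` and `v` if both degrees exceed `D`, or if one of `u`, `v` is the highest-degree neighbour of
the other one. -/
def keptEdges (G : AdjLists n) (D : ℝ) : Set (Sym2 (Fin n) × ℕ) :=
  {e | e.2 = 1 ∧ ∃ u v : Fin n, e.1 = s(u, v) ∧ v ∈ G u ∧
    ((D < G.deg u ∧ D < G.deg v) ∨ G.IsTopNeighbour u v ∨ G.IsTopNeighbour v u)}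

/-! ### Probes

In the registers of a machine the vertices are the numbers `1, …, n`, and `0` stands for `⊥`. -/

/-- The vertex with number `a`, if there is one. -/
def vertexOf (n a : ℕ) : Option (Fin n) :=
  if h : 1 ≤ a ∧ a ≤ n then some ⟨a - 1, by omega⟩ else none

/-- `Exists(u, v)`. -/
def existsProbe (G : AdjLists n) (a b : ℕ) : ℕ :=
  match vertexOf n a, vertexOf n b with
  | some u, some v => if v ∈ G u then 1 else 0
  | _, _ => 0

/-- `Deg(v)`. -/
def degProbe (G : AdjLists n) (a : ℕ) : ℕ :=
  match vertexOf n a with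
  | some v => G.deg v
  | none => 0

/-- `Nbr(v, j)`: the `j`-th entry of the adjacency list of `v` (counted from `1`), and `⊥` if there
is no such entry or if the same neighbour already stands earlier in the list. -/
def nbrProbe (G : AdjLists n) (a j : ℕ) : ℕ :=
  match vertexOf n a with
  | none => 0
  | some v =>
    if j = 0 then 0
    else
      match (G v)[j - 1]? with
      | none => 0
      | some w => if w ∈ (G v).take (j - 1) then 0 else (w : ℕ) + 1

end AdjLists

/-! ### Programs with probes, and their running time -/

/-- Programs of a register machine with probe access to a graph. Registers are named by natural
numbers and hold natural numbers; a program is finite, so it uses finitely many of them. -/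
inductive ProbeProgram : Type
  /-- `r := c` -/
  | const (r c : ℕ)
  /-- `r := s` -/
  | copy (r s : ℕ)
  /-- `r := s + t` -/
  | plus (r s t : ℕ)
  /-- `r := s - t`, truncated at `0` -/
  | minus (r s t : ℕ)
  /-- `r := Exists(s, t)` -/
  | probeExists (r s t : ℕ)
  /-- `r := Deg(s)` -/
  | probeDeg (r s : ℕ)
  /-- `r := Nbr(s, t)` -/
  | probeNbr (r s t : ℕ)
  /-- `p; q` -/
  | seq (p q : ProbeProgram)
  /-- `if r < s then p else q` -/
  | ifLt (r s : ℕ) (p q : ProbeProgram)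
  /-- `while r < s do p` -/
  | whileLt (r s : ℕ) (p : ProbeProgram)

namespace ProbeProgram

open Function

/-- `Runs G p x y t`: with probe access to `G` the program `p`, started with register contents `x`,
halts with register contents `y` after exactly `t` time steps. Each assignment, each probe and each
evaluation of a test takes one step. -/
inductive Runs {n : ℕ} (G : AdjLists n) : ProbeProgram → (ℕ → ℕ) → (ℕ → ℕ) → ℕ → Prop
  | const (r c : ℕ) (x : ℕ → ℕ) : Runs G (.const r c) x (update x r c) 1
  | copy (r s : ℕ) (x : ℕ → ℕ) : Runs G (.copy r s) x (update x r (x s)) 1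
  | plus (r s t : ℕ) (x : ℕ → ℕ) : Runs G (.plus r s t) x (update x r (x s + x t)) 1
  | minus (r s t : ℕ) (x : ℕ → ℕ) : Runs G (.minus r s t) x (update x r (x s - x t)) 1
  | probeExists (r s t : ℕ) (x : ℕ → ℕ) :
      Runs G (.probeExists r s t) x (update x r (G.existsProbe (x s) (x t))) 1
  | probeDeg (r s : ℕ) (x : ℕ → ℕ) :
      Runs G (.probeDeg r s) x (update x r (G.degProbe (x s))) 1
  | probeNbr (r s t : ℕ) (x : ℕ → ℕ) :
      Runs G (.probeNbr r s t) x (update x r (G.nbrProbe (x s) (x t))) 1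
  | seq (p q : ProbeProgram) (x y z : ℕ → ℕ) (a b : ℕ) :
      Runs G p x y a → Runs G q y z b → Runs G (.seq p q) x z (a + b)
  | ifTrue (r s : ℕ) (p q : ProbeProgram) (x y : ℕ → ℕ) (a : ℕ) :
      x r < x s → Runs G p x y a → Runs G (.ifLt r s p q) x y (a + 1)
  | ifFalse (r s : ℕ) (p q : ProbeProgram) (x y : ℕ → ℕ) (a : ℕ) :
      ¬ x r < x s → Runs G q x y a → Runs G (.ifLt r s p q) x y (a + 1)
  | whileStep (r s : ℕ) (p : ProbeProgram) (x y z : ℕ → ℕ) (a b : ℕ) :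
      x r < x s → Runs G p x y a → Runs G (.whileLt r s p) y z b →
        Runs G (.whileLt r s p) x z (a + b + 1)
  | whileEnd (r s : ℕ) (p : ProbeProgram) (x : ℕ → ℕ) :
      ¬ x r < x s → Runs G (.whileLt r s p) x x 1

/-- A run is determined by the program, the graph and the initial register contents. -/
theorem Runs.deterministic {n : ℕ} {G : AdjLists n} {p : ProbeProgram} {x y y' : ℕ → ℕ}
    {t t' : ℕ} (h : Runs G p x y t) (h' : Runs G p x y' t') : y = y' ∧ t = t' := by
  induction h generalizing y' t' with
  | seq p q x y z a b _ _ ih₁ ih₂ =>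
    cases h' with
    | seq _ _ _ y₂ _ a₂ b₂ h₁ h₂ =>
      obtain ⟨rfl, rfl⟩ := ih₁ h₁
      obtain ⟨rfl, rfl⟩ := ih₂ h₂
      exact ⟨rfl, rfl⟩
  | ifTrue r s p q x y a hx _ ih =>
    cases h' with
    | ifTrue _ _ _ _ _ _ a₂ _ h₁ =>
      obtain ⟨rfl, rfl⟩ := ih h₁
      exact ⟨rfl, rfl⟩
    | ifFalse _ _ _ _ _ _ a₂ hx' h₁ => exact absurd hx hx'
  | ifFalse r s p q x y a hx _ ih =>
    cases h' with
    | ifTrue _ _ _ _ _ _ a₂ hx' h₁ => exact absurd hx' hx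
    | ifFalse _ _ _ _ _ _ a₂ _ h₁ =>
      obtain ⟨rfl, rfl⟩ := ih h₁
      exact ⟨rfl, rfl⟩
  | whileStep r s p x y z a b hx _ _ ih₁ ih₂ =>
    cases h' with
    | whileStep _ _ _ _ y₂ _ a₂ b₂ _ h₁ h₂ =>
      obtain ⟨rfl, rfl⟩ := ih₁ h₁
      obtain ⟨rfl, rfl⟩ := ih₂ h₂
      exact ⟨rfl, rfl⟩
    | whileEnd _ _ _ _ hx' => exact absurd hx hx'
  | whileEnd r s p x hx =>
    cases h' with
    | whileStep _ _ _ _ y₂ _ a₂ b₂ hx' h₁ h₂ => exact absurd hx' hx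
    | whileEnd => exact ⟨rfl, rfl⟩
  | _ => cases h'; exact ⟨rfl, rfl⟩

/-- The initial register contents for the query `(u, v, i)`: registers `0`, `1`, `2` hold `u`, `v`,
`i`, registers `3`, `4`, `5` hold the parameters `n`, `μ` and the degree threshold, and all other
registers hold `0` (in particular nothing is remembered from earlier queries). -/
def start {n : ℕ} {G : AdjLists n} (μ threshold : ℕ) (q : G.Query) : ℕ → ℕ
  | 0 => (q.1 : ℕ) + 1
  | 1 => (q.2.1 : ℕ) + 1
  | 2 => (q.2.2 : ℕ) + 1
  | 3 => n
  | 4 => μ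
  | 5 => threshold
  | _ => 0

/-- On the query `q` the program `p` halts after `t` steps with the answer `b` in register `0`
(`1` for yes, `0` for no). -/
def Answers {n : ℕ} (G : AdjLists n) (p : ProbeProgram) (μ threshold : ℕ) (q : G.Query)
    (b : Bool) (t : ℕ) : Prop :=
  ∃ y : ℕ → ℕ, Runs G p (start μ threshold q) y t ∧ y 0 = b.toNat

end ProbeProgram

/-! ### Uniform attachment graphs -/

/-- The random choices of the uniform attachment model. The vertices are numbered `0, …, n - 1` by
arrival; vertex `i + 1` makes `μ` choices among the vertices `0, …, i` that exist when it
arrives. -/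
abbrev UAChoices (n μ : ℕ) : Type := (i : Fin (n - 1)) → Fin μ → Fin ((i : ℕ) + 1)

/-- All choices are uniform and independent. -/
noncomputable def uaMeasure (n μ : ℕ) : Measure (UAChoices n μ) :=
  Measure.pi fun i => Measure.pi fun _ => (PMF.uniformOfFintype (Fin ((i : ℕ) + 1))).toMeasure

/-- The number of edges between the vertices that arrive as number `a` and as number `b`. -/
def uaMult {n μ : ℕ} (ω : UAChoices n μ) (a b : Fin n) : ℕ :=
  (Finset.univ.filter fun p : Fin (n - 1) × Fin μ =>
    ((p.1 : ℕ) + 1 = a ∧ (ω p.1 p.2 : ℕ) = b) ∨ ((p.1 : ℕ) + 1 = b ∧ (ω p.1 p.2 : ℕ) = a)).card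

/-- `G` is the uniform attachment graph with the choices `ω`, under some relabelling of the
vertices and with adjacency lists in some order. So the labels and the lists carry no information
about the order of arrival that an algorithm could rely on. -/
def PresentsUA {n μ : ℕ} (ω : UAChoices n μ) (G : AdjLists n) : Prop :=
  ∃ σ : Equiv.Perm (Fin n), ∀ a b : Fin n, G.mult (σ a) (σ b) = uaMult ω a b

/-- The threshold `D = μ (H_{n-1} - H_6) + μ / 2`, with harmonic numbers `H_k`. -/
noncomputable def uaThreshold (n μ : ℕ) : ℝ :=
  (μ : ℝ) * ((harmonic (n - 1) : ℝ) - (harmonic 6 : ℝ)) + (μ : ℝ) / 2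

/-! Number the arrivals from 0. Vertex `a` is hit by each choice of vertex `i + 1`, `i ≥ a`, with
probability `1/(i+1)`, so for `a > 0` its expected degree is `μ (1 + H_{n-1} - H_a)`: older vertices
have larger degrees. For `μ` a large multiple of `log² n`, Chernoff bounds put all in-degrees within
`μ/50` of their means, so that degrees reveal the order of arrival up to a constant factor.
`Regular` collects this and two statements about choices that are not all avoided;
`measureReal_not_regular_le` shows that it fails with probability at most `1/n`. The claims about
the spanner are then deterministic consequences.

On a regular outcome the vertices above the threshold are exactly the eleven oldest ones, which form
a clique (`Regular.uaThreshold_lt_iff`). This gives at most `11²` kept edges besides one per vertex.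
Any younger vertex has a neighbour in the older half, so its highest-degree neighbour has at most
2/3 of its index (`Regular.three_mul_top_le`). Following such neighbours leads into the clique in
`O(log n)` steps. Hence the kept edges have diameter `O(log n)`, which already makes them a spanner.

The program searches only lists of endpoints not above the threshold. This bounds its time on every
outcome, and on regular outcomes it loses nothing, because the highest-degree neighbour of an old
vertex is old as well (`Regular.kept_iff`). The mean of `d_u + d_v` is `2 ∑ d² / ∑ d`, which is
`O(μ)` since the squares `(H_m - H_a)²` sum to at most `2m`; irregular outcomes add at most `O(μ log
n) / n` to the expected running time. -/

namespace ProbeProgram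

open Function

/-! ### Program logic for time-bounded total correctness -/

/-- Total correctness with a time bound: from the register contents `x` the program halts within
`T` steps in a state that satisfies `Q`. -/
def Halts {n : ℕ} (G : AdjLists n) (p : ProbeProgram) (x : ℕ → ℕ) (T : ℕ)
    (Q : (ℕ → ℕ) → Prop) : Prop :=
  ∃ y t, Runs G p x y t ∧ t ≤ T ∧ Q y

section Rules

variable {n : ℕ} {G : AdjLists n} {x : ℕ → ℕ} {Q R : (ℕ → ℕ) → Prop} {p q : ProbeProgram}

theorem Halts.mono {S T : ℕ} (h : Halts G p x S R) (hST : S ≤ T) (hRQ : ∀ y, R y → Q y) :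
    Halts G p x T Q := by
  obtain ⟨y, t, hr, ht, hy⟩ := h
  exact ⟨y, t, hr, ht.trans hST, hRQ y hy⟩

theorem Halts.const {r c : ℕ} (h : Q (update x r c)) : Halts G (.const r c) x 1 Q :=
  ⟨_, _, .const .., le_rfl, h⟩

theorem Halts.copy {r s : ℕ} (h : Q (update x r (x s))) : Halts G (.copy r s) x 1 Q :=
  ⟨_, _, .copy .., le_rfl, h⟩

theorem Halts.plus {r s t : ℕ} (h : Q (update x r (x s + x t))) : Halts G (.plus r s t) x 1 Q :=
  ⟨_, _, .plus .., le_rfl, h⟩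

theorem Halts.probeDeg {r s : ℕ} (h : Q (update x r (G.degProbe (x s)))) :
    Halts G (.probeDeg r s) x 1 Q :=
  ⟨_, _, .probeDeg .., le_rfl, h⟩

theorem Halts.probeNbr {r s t : ℕ} (h : Q (update x r (G.nbrProbe (x s) (x t)))) :
    Halts G (.probeNbr r s t) x 1 Q :=
  ⟨_, _, .probeNbr .., le_rfl, h⟩

theorem Halts.seq (S T : ℕ) {U : ℕ} (hU : S + T ≤ U)
    (h : Halts G p x S (fun y => Halts G q y T Q)) : Halts G (.seq p q) x U Q := by
  obtain ⟨y, t, hr, ht, z, s, hr', hs, hz⟩ := h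
  exact ⟨z, t + s, .seq _ _ _ _ _ _ _ hr hr', by omega, hz⟩

theorem Halts.ifLt {r s T : ℕ} (h₁ : x r < x s → Halts G p x T Q)
    (h₂ : ¬ x r < x s → Halts G q x T Q) : Halts G (.ifLt r s p q) x (T + 1) Q := by
  by_cases h : x r < x s
  · obtain ⟨y, t, hr, ht, hy⟩ := h₁ h
    exact ⟨y, t + 1, .ifTrue _ _ _ _ _ _ _ h hr, by omega, hy⟩
  · obtain ⟨y, t, hr, ht, hy⟩ := h₂ h
    exact ⟨y, t + 1, .ifFalse _ _ _ _ _ _ _ h hr, by omega, hy⟩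

end Rules

/-! ### The program and its subroutine for searching a list -/

/-- One round of the search through the adjacency list of (the vertex in register) `a`: if its next
entry beats `b` as highest-degree neighbour, register `11` is cleared. -/
def scanStep (a b db : ℕ) : ProbeProgram :=
  .seq (.plus 10 10 8) <| .seq (.probeNbr 12 a 10) <| .seq (.probeDeg 13 12) <|
    .ifLt db 13 (.const 11 0) <|
      .ifLt 13 db (.copy 11 11) <|
        .ifLt 12 b (.const 11 0) (.copy 11 11)

/-- Sets register `9` to `1` if `b` is the highest-degree neighbour of `a`; the registers `da`, `db`
hold the degrees. -/
def scan (a b da db : ℕ) : ProbeProgram :=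
  .seq (.const 10 0) <| .seq (.const 11 1) <| .seq (.whileLt 10 da (scanStep a b db)) <|
    .ifLt 14 11 (.const 9 1) (.copy 9 9)

/-- The `j`-th entry of the list of `a` has degree greater than `d`, or degree `d` and a number
smaller than `b`. -/
def Beats {n : ℕ} (G : AdjLists n) (a b d j : ℕ) : Prop :=
  d < G.degProbe (G.nbrProbe a j) ∨ (G.degProbe (G.nbrProbe a j) = d ∧ G.nbrProbe a j < b)

theorem halts_scanStep {n : ℕ} (G : AdjLists n) {a b db : ℕ} (ha : a < 9) (hb : b < 9)
    (hdb : db < 9) (x : ℕ → ℕ) (h8 : x 8 = 1) :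
    Halts G (scanStep a b db) x 7 (fun y =>
      (∀ r, r < 10 ∨ r = 14 → y r = x r) ∧ y 10 = x 10 + 1 ∧
      (0 < y 11 ↔ 0 < x 11 ∧ ¬ Beats G (x a) (x b) (x db) (x 10 + 1))) := by
  have e : ∀ {r : ℕ}, r < 9 → r ≠ 10 ∧ r ≠ 11 ∧ r ≠ 12 ∧ r ≠ 13 := by omega
  obtain ⟨a0, a1, a2, a3⟩ := e ha
  obtain ⟨b0, b1, b2, b3⟩ := e hb
  obtain ⟨d0, d1, d2, d3⟩ := e hdb
  have key : ∀ r, r < 10 ∨ r = 14 → r ≠ 10 ∧ r ≠ 11 ∧ r ≠ 12 ∧ r ≠ 13 := by omega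
  refine Halts.mono (Halts.seq 1 6 (by omega) <| Halts.plus <| Halts.seq 1 5 (by omega) <|
    Halts.probeNbr <| Halts.seq 1 4 (by omega) <| Halts.probeDeg <|
    Halts.ifLt (T := 3) (fun h => ?_) (fun h => Halts.ifLt (T := 2) (fun h' => ?_)
      (fun h' => Halts.ifLt (T := 1) (fun h'' => ?_) (fun h'' => ?_)))) le_rfl (fun y hy => hy)
  · refine Halts.mono (Halts.const (Q := _) ?_) (by norm_num : 1 ≤ 3) (fun y hy => hy)
    simp [a0, d0, d2, d3, h8] at h
    refine ⟨fun r hr => ?_, by simp [h8], by simp [Beats, h]⟩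
    obtain ⟨r0, r1, r2, r3⟩ := key r hr
    simp [r0, r1, r2, r3]
  · refine Halts.mono (Halts.copy (Q := _) ?_) (by norm_num : 1 ≤ 2) (fun y hy => hy)
    simp [a0, d0, d2, d3, h8] at h h'
    refine ⟨fun r hr => ?_, by simp [h8], ?_⟩
    · obtain ⟨r0, r1, r2, r3⟩ := key r hr
      simp [r0, r1, r2, r3]
    · simp only [Beats]
      have h1 := h'.ne
      have h2 := h'.not_gt
      simp [h1, h2]
  · refine Halts.const ?_
    simp [a0, b0, b2, b3, d0, d2, d3, h8] at h h' h''
    refine ⟨fun r hr => ?_, by simp [h8], by simp [Beats, h'', le_antisymm h h']⟩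
    obtain ⟨r0, r1, r2, r3⟩ := key r hr
    simp [r0, r1, r2, r3]
  · refine Halts.copy ?_
    simp [a0, b0, b2, b3, d0, d2, d3, h8] at h h' h''
    refine ⟨fun r hr => ?_, by simp [h8], by simp [Beats, h'', le_antisymm h h']⟩
    obtain ⟨r0, r1, r2, r3⟩ := key r hr
    simp [r0, r1, r2, r3]

/-- Loop invariant: register `11` is positive as long as no entry read so far beats `b`. A round
costs 7 steps and one loop test. The operands sit in registers below 9, which a round never writes.
-/
theorem halts_scanLoop {n : ℕ} (G : AdjLists n) {a b da db : ℕ} (ha : a < 9) (hb : b < 9)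
    (hda : da < 9) (hdb : db < 9) (k : ℕ) (x : ℕ → ℕ) (h8 : x 8 = 1) (hk : x da = x 10 + k) :
    Halts G (.whileLt 10 da (scanStep a b db)) x (8 * k + 1) (fun y =>
      (∀ r, r < 10 ∨ r = 14 → y r = x r) ∧
      (0 < y 11 ↔ 0 < x 11 ∧
        ∀ j, x 10 < j → j ≤ x da → ¬ Beats G (x a) (x b) (x db) j)) := by
  induction k generalizing x with
  | zero =>
    exact ⟨x, 1, .whileEnd _ _ _ _ (by omega), by omega, fun _ _ => rfl,
      ⟨fun h => ⟨h, fun j h1 h2 => by omega⟩, fun h => h.1⟩⟩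
  | succ k ih =>
    obtain ⟨y, t, hr, ht, hy, hy10, hy11⟩ := halts_scanStep G ha hb hdb x h8
    have fa := hy a (by omega)
    have fb := hy b (by omega)
    have fda := hy da (by omega)
    have fdb := hy db (by omega)
    obtain ⟨z, s, hr', hs, hz, hz11⟩ := ih y (by rw [hy 8 (by omega), h8]) (by omega)
    refine ⟨z, t + s + 1, .whileStep _ _ _ _ _ _ _ _ (by omega) hr hr', by omega,
      fun r hr => (hz r hr).trans (hy r hr), ?_⟩
    rw [hz11, hy11, fa, fb, fda, fdb, hy10]
    constructor
    · rintro ⟨⟨h1, h2⟩, h3⟩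
      refine ⟨h1, fun j hj hj' => ?_⟩
      rcases Nat.lt_or_ge (x 10 + 1) j with h | h
      · exact h3 j h hj'
      · obtain rfl : j = x 10 + 1 := by omega
        exact h2
    · rintro ⟨h1, h2⟩
      exact ⟨⟨h1, h2 _ (by omega) (by omega)⟩, fun j hj hj' => h2 j (by omega) hj'⟩

theorem halts_scan {n : ℕ} (G : AdjLists n) {a b da db : ℕ} (ha : a < 9) (hb : b < 9)
    (hda : da < 9) (hdb : db < 9) (x : ℕ → ℕ) (h8 : x 8 = 1) (h14 : x 14 = 0) :
    Halts G (scan a b da db) x (8 * x da + 5) (fun y =>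
      (∀ r, r < 9 ∨ r = 14 → y r = x r) ∧
      ((∀ j, 1 ≤ j → j ≤ x da → ¬ Beats G (x a) (x b) (x db) j) → y 9 = 1) ∧
      (¬ (∀ j, 1 ≤ j → j ≤ x da → ¬ Beats G (x a) (x b) (x db) j) → y 9 = x 9)) := by
  have e : ∀ {r : ℕ}, r < 9 → r ≠ 10 ∧ r ≠ 11 := by omega
  obtain ⟨a0, a1⟩ := e ha
  obtain ⟨b0, b1⟩ := e hb
  obtain ⟨da0, da1⟩ := e hda
  obtain ⟨db0, db1⟩ := e hdb
  have hloop := halts_scanLoop G ha hb hda hdb (x da) (update (update x 10 0) 11 1)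
    (by simp [h8]) (by simp [da0, da1])
  refine Halts.seq 1 (8 * x da + 4) (by omega) <| Halts.const <|
    Halts.seq 1 (8 * x da + 3) (by omega) <| Halts.const <|
    Halts.seq (8 * x da + 1) (2) (by omega) <| hloop.mono le_rfl ?_
  rintro y ⟨hy, hy11⟩
  simp only [ne_eq, a0, a1, b0, b1, da0, da1, db0, db1, not_false_eq_true, update_of_ne,
    update_self, zero_lt_one, true_and,
    show (10 : ℕ) ≠ 11 by norm_num] at hy11
  -- Register `14` is never written and serves as the constant 0 in the final test of the flag.
  have hy14 : y 14 = 0 := by rw [hy 14 (by omega)]; simp [h14]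
  have frame : ∀ r, r < 10 ∨ r = 14 → y r = x r := fun r hr => by
    rw [hy r hr, update_of_ne (by omega), update_of_ne (by omega)]
  refine Halts.ifLt (T := 1) (fun h => ?_) (fun h => ?_)
  · refine Halts.const ⟨fun r hr => ?_, fun _ => by simp, fun h' => ?_⟩
    · rw [update_of_ne (by omega), frame r (by omega)]
    · exact absurd (hy11.1 (by omega)) h'
  · refine Halts.copy ⟨fun r hr => ?_, fun h' => ?_, fun _ => ?_⟩
    · rw [update_of_ne (by omega), frame r (by omega)]
    · have := hy11.2 h'
      omega
    · simp [frame 9 (by omega)]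

/-- The local spanner algorithm. Parallel copies are rejected, edges between two vertices above
the threshold are accepted, and otherwise the lists of the endpoints that are not above the
threshold are searched. -/
def spannerProgram : ProbeProgram :=
  .seq (.const 8 1) <| .seq (.const 9 0) <|
    .seq (.ifLt 8 2 (.copy 9 9) <|
      .seq (.probeDeg 6 0) <| .seq (.probeDeg 7 1) <|
        .ifLt 5 6
          (.ifLt 5 7 (.const 9 1) (scan 1 0 7 6))
          (.seq (scan 0 1 6 7) (.ifLt 5 7 (.copy 9 9) (scan 1 0 7 6))))
      (.copy 0 9)

end ProbeProgram

/-! ### What the probes reveal about neighbours -/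

namespace AdjLists

variable {n : ℕ}

theorem vertexOf_succ (v : Fin n) : vertexOf n ((v : ℕ) + 1) = some v := by
  simp [vertexOf, v.2]

theorem degProbe_succ (G : AdjLists n) (v : Fin n) : G.degProbe ((v : ℕ) + 1) = G.deg v := by
  simp [degProbe, vertexOf_succ]

theorem degProbe_zero (G : AdjLists n) : G.degProbe 0 = 0 := by
  simp [degProbe, vertexOf]

theorem nbrProbe_eq_zero_or (G : AdjLists n) (u : Fin n) (j : ℕ) :
    G.nbrProbe ((u : ℕ) + 1) j = 0 ∨ ∃ w ∈ G u, G.nbrProbe ((u : ℕ) + 1) j = (w : ℕ) + 1 := by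
  simp only [nbrProbe, vertexOf_succ]
  split_ifs with h
  · simp
  · rcases hw : (G u)[j - 1]? with _ | w
    · simp
    · simp only
      split_ifs with h'
      · simp
      · exact .inr ⟨w, List.mem_of_getElem? hw, rfl⟩

/-- The probe masks only repetitions, so the first occurrence of `w` is still visible. -/
theorem exists_nbrProbe_eq (G : AdjLists n) {u w : Fin n} (hw : w ∈ G u) :
    ∃ j, 1 ≤ j ∧ j ≤ G.deg u ∧ G.nbrProbe ((u : ℕ) + 1) j = (w : ℕ) + 1 := by
  have hi : (G u).idxOf w < (G u).length := List.idxOf_lt_length_of_mem hw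
  refine ⟨(G u).idxOf w + 1, by omega, hi, ?_⟩
  have h1 : (G u)[(G u).idxOf w]? = some w := by
    rw [List.getElem?_eq_getElem hi, List.getElem_idxOf hi]
  have h2 : w ∉ (G u).take ((G u).idxOf w) := by
    intro h
    obtain ⟨i, hi', he⟩ := List.mem_take_iff_getElem.1 h
    have : (G u).idxOf w ≤ i := by
      by_contra hc
      have := List.not_of_lt_findIdx (p := (· == w)) (xs := G u)
        (by simpa [List.idxOf] using Nat.lt_of_not_le hc)
      simp [he] at this
    omega
  simp [nbrProbe, vertexOf_succ, h1, h2]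

/-- The search through the list of `u` finds nothing better than `v` exactly if `v` is the
highest-degree neighbour. -/
theorem forall_not_beats_iff (G : AdjLists n) {u v : Fin n} (hv : v ∈ G u) (hd : 0 < G.deg v) :
    (∀ j, 1 ≤ j → j ≤ G.deg u →
      ¬ ProbeProgram.Beats G ((u : ℕ) + 1) ((v : ℕ) + 1) (G.deg v) j) ↔ G.IsTopNeighbour u v := by
  constructor
  · refine fun h => ⟨hv, fun w hw => ?_⟩
    obtain ⟨j, h1, h2, h3⟩ := G.exists_nbrProbe_eq hw
    have := h j h1 h2
    simp only [ProbeProgram.Beats, h3, degProbe_succ, not_or, not_and] at this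
    rcases lt_or_eq_of_le (not_lt.1 this.1) with h4 | h4
    · exact .inl h4
    · refine .inr ⟨h4, ?_⟩
      have := this.2 h4
      rw [Fin.le_def]
      omega
  · rintro ⟨-, h⟩ j h1 h2
    rcases G.nbrProbe_eq_zero_or u j with h3 | ⟨w, hw, h3⟩
    -- A masked entry reads as `0`, with degree `0`. It would win a tie by its small number, which
    -- is excluded because `v` has positive degree.
    · simp only [ProbeProgram.Beats, h3, degProbe_zero]
      omega
    · simp only [ProbeProgram.Beats, h3, degProbe_succ]
      rcases h w hw with h4 | ⟨h4, h5⟩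
      · omega
      · rw [Fin.le_def] at h5
        omega

end AdjLists

/-! ### Correctness and running time of the program -/

namespace ProbeProgram

open Function AdjLists

/-- The postcondition records what the program computes on an arbitrary graph. This can differ from
membership in the kept edges, as lists of endpoints above `θ` are not searched; it is also why only
degrees up to `θ` enter the time bound. -/
theorem halts_spannerProgram {n : ℕ} {G : AdjLists n} (μ θ : ℕ) (q : G.Query)
    (huv : q.2.1 ∈ G q.1) (hvu : q.1 ∈ G q.2.1) :
    Halts G spannerProgram (start μ θ q)
      (18 + (if G.deg q.1 ≤ θ then 8 * G.deg q.1 else 0) +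
        (if G.deg q.2.1 ≤ θ then 8 * G.deg q.2.1 else 0)) (fun y =>
      ((q.2.2 : ℕ) = 0 ∧ ((θ < G.deg q.1 ∧ θ < G.deg q.2.1) ∨
        (G.deg q.1 ≤ θ ∧ G.IsTopNeighbour q.1 q.2.1) ∨
        (G.deg q.2.1 ≤ θ ∧ G.IsTopNeighbour q.2.1 q.1)) → y 0 = 1) ∧
      (¬ ((q.2.2 : ℕ) = 0 ∧ ((θ < G.deg q.1 ∧ θ < G.deg q.2.1) ∨
        (G.deg q.1 ≤ θ ∧ G.IsTopNeighbour q.1 q.2.1) ∨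
        (G.deg q.2.1 ≤ θ ∧ G.IsTopNeighbour q.2.1 q.1))) → y 0 = 0)) := by
  obtain ⟨u, v, i⟩ := q
  simp only at huv hvu ⊢
  have hdu : 0 < G.deg u := List.length_pos_of_mem huv
  have hdv : 0 < G.deg v := List.length_pos_of_mem hvu
  set x := start μ θ (⟨u, v, i⟩ : G.Query) with hx
  have x0 : x 0 = (u : ℕ) + 1 := rfl
  have x1 : x 1 = (v : ℕ) + 1 := rfl
  have x2 : x 2 = (i : ℕ) + 1 := rfl
  have x5 : x 5 = θ := rfl
  have x14 : x 14 = 0 := rfl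
  -- From here on only the listed register values matter.
  clear_value x
  have hUV := G.forall_not_beats_iff huv hdv
  have hVU := G.forall_not_beats_iff hvu hdu
  refine Halts.seq 1 (17 + ((if G.deg u ≤ θ then 8 * G.deg u else 0) +
        (if G.deg v ≤ θ then 8 * G.deg v else 0))) (by omega) <| Halts.const <|
    Halts.seq 1 (16 + ((if G.deg u ≤ θ then 8 * G.deg u else 0) +
        (if G.deg v ≤ θ then 8 * G.deg v else 0))) (by omega) <| Halts.const <|
    Halts.seq (15 + ((if G.deg u ≤ θ then 8 * G.deg u else 0) +
        (if G.deg v ≤ θ then 8 * G.deg v else 0))) (1) (by omega) <|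
    Halts.mono (Halts.ifLt (T := 14 + ((if G.deg u ≤ θ then 8 * G.deg u else 0) +
        (if G.deg v ≤ θ then 8 * G.deg v else 0))) (fun h => ?_) (fun h => ?_)) (by omega)
      (fun y hy => hy)
  · refine Halts.mono (Halts.copy (Q := _) ?_) (by omega : 1 ≤ _) (fun y hy => hy)
    refine Halts.copy ?_
    have hi : (i : ℕ) ≠ 0 := by simpa [x2, Nat.pos_iff_ne_zero] using h
    simp [hi]
  have hi : (i : ℕ) = 0 := by simpa [x2] using h
  refine Halts.seq 1 (13 + ((if G.deg u ≤ θ then 8 * G.deg u else 0) +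
        (if G.deg v ≤ θ then 8 * G.deg v else 0))) (by omega) <| Halts.probeDeg <|
    Halts.seq 1 (12 + ((if G.deg u ≤ θ then 8 * G.deg u else 0) +
        (if G.deg v ≤ θ then 8 * G.deg v else 0))) (by omega) <| Halts.probeDeg ?_
  set z : ℕ → ℕ := update (update (update (update x 8 1) 9 0) 6 _) 7 _ with hz
  have z0 : z 0 = (u : ℕ) + 1 := by simp [hz, x0]
  have z1 : z 1 = (v : ℕ) + 1 := by simp [hz, x1]
  have z5 : z 5 = θ := by simp [hz, x5]
  have z6 : z 6 = G.deg u := by simp [hz, x0, degProbe_succ]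
  have z7 : z 7 = G.deg v := by simp [hz, x1, degProbe_succ]
  have z8 : z 8 = 1 := by simp [hz]
  have z9 : z 9 = 0 := by simp [hz]
  have z14 : z 14 = 0 := by simp [hz, x14]
  clear_value z
  clear hz
  refine Halts.mono (Halts.ifLt (T := 11 + ((if G.deg u ≤ θ then 8 * G.deg u else 0) +
        (if G.deg v ≤ θ then 8 * G.deg v else 0))) (fun h5 => ?_) (fun h5 => ?_)) (by omega)
      (fun y hy => hy)
  · rw [z5, z6] at h5
    refine Halts.mono (Halts.ifLt (T := 10 + ((if G.deg u ≤ θ then 8 * G.deg u else 0) +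
        (if G.deg v ≤ θ then 8 * G.deg v else 0))) (fun h6 => ?_) (fun h6 => ?_)) (by omega)
      (fun y hy => hy)
    · rw [z5, z7] at h6
      refine Halts.mono (Halts.const (Q := _) ?_) (by omega : 1 ≤ _) (fun y hy => hy)
      refine Halts.copy ?_
      simp [hi, h5, h6]
    · rw [z5, z7, not_lt] at h6
      refine Halts.mono (halts_scan G (by norm_num) (by norm_num) (by norm_num) (by norm_num) z
        z8 z14) (by rw [z7]; simp [h6]; omega) ?_
      rintro y ⟨-, hy1, hy2⟩
      rw [z0, z1, z6, z7, hVU] at hy1 hy2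
      refine Halts.copy ?_
      rw [z9] at hy2
      simp only [hi, h5, h6, h6.not_gt, h5.not_ge, update_self, true_and, false_and, and_false,
        false_or]
      exact ⟨hy1, hy2⟩
  · rw [z5, z6, not_lt] at h5
    refine Halts.seq (8 * G.deg u + 5) (6 + (if G.deg v ≤ θ then 8 * G.deg v else 0))
      (by simp [h5]; omega) ?_
    refine Halts.mono (halts_scan G (by norm_num) (by norm_num) (by norm_num) (by norm_num) z
        z8 z14) (by rw [z6]) ?_
    rintro y ⟨hy, hy1, hy2⟩
    rw [z0, z1, z6, z7, hUV] at hy1 hy2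
    rw [z9] at hy2
    have y0 := (hy 0 (by omega)).trans z0
    have y1 := (hy 1 (by omega)).trans z1
    have y5 := (hy 5 (by omega)).trans z5
    have y6 := (hy 6 (by omega)).trans z6
    have y7 := (hy 7 (by omega)).trans z7
    have y8 := (hy 8 (by omega)).trans z8
    have y14 := (hy 14 (by omega)).trans z14
    refine Halts.mono (Halts.ifLt (T := 5 + (if G.deg v ≤ θ then 8 * G.deg v else 0))
      (fun h6 => ?_) (fun h6 => ?_)) (by omega) (fun y hy => hy)
    · rw [y5, y7] at h6
      refine Halts.mono (Halts.copy (Q := _) ?_) (by omega : 1 ≤ _) (fun y hy => hy)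
      refine Halts.copy ?_
      simp only [hi, h5, h6, h6.not_ge, h5.not_gt, update_self, true_and, false_and,
        false_or, or_false]
      exact ⟨hy1, hy2⟩
    · rw [y5, y7, not_lt] at h6
      refine Halts.mono (halts_scan G (by norm_num) (by norm_num) (by norm_num) (by norm_num) y
        y8 y14) (by rw [y7]; simp [h6]; omega) ?_
      rintro w ⟨-, hw1, hw2⟩
      rw [y0, y1, y6, y7, hVU] at hw1 hw2
      refine Halts.copy ?_
      simp only [hi, h5, h6, h6.not_gt, h5.not_gt, update_self, true_and, and_false,
        false_or]
      constructor
      · intro h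
        by_cases h' : G.IsTopNeighbour v u
        · exact hw1 h'
        · rw [hw2 h', hy1 (h.resolve_right h')]
      · intro h
        rw [hw2 (fun h' => h (.inr h')), hy2 (fun h' => h (.inl h'))]

end ProbeProgram

/-! ### Harmonic numbers -/

/-- The harmonic numbers as reals. -/
noncomputable def harm (k : ℕ) : ℝ := ((harmonic k : ℚ) : ℝ)

theorem harm_zero : harm 0 = 0 := by simp [harm]

theorem harm_succ (k : ℕ) : harm (k + 1) = harm k + 1 / ((k : ℝ) + 1) := by
  simp [harm, harmonic_succ]

theorem harm_one : harm 1 = 1 := by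
  rw [show (1 : ℕ) = 0 + 1 by rfl, harm_succ, harm_zero]
  norm_num

theorem harm_mono : Monotone harm :=
  monotone_nat_of_le_succ fun k => by
    rw [harm_succ]
    have : 0 ≤ 1 / ((k : ℝ) + 1) := by positivity
    linarith

theorem harm_nonneg (k : ℕ) : 0 ≤ harm k := harm_zero ▸ harm_mono (Nat.zero_le k)

theorem harm_ten : harm 10 = harm 6 + 1207 / 2520 := by
  rw [harm_succ 9, harm_succ 8, harm_succ 7, harm_succ 6]
  norm_num
  ring

theorem harm_eleven : harm 11 = harm 6 + 15797 / 27720 := by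
  rw [harm_succ 10, harm_ten]
  norm_num
  ring

theorem one_le_harm_six : 1 ≤ harm 6 := harm_one ▸ harm_mono (by norm_num)

/-- Each of the `w - a` terms of `H_w - H_a` is at least `1/w`. -/
theorem sub_le_mul_harm_sub {a w : ℕ} (h : a ≤ w) :
    (w : ℝ) - a ≤ w * (harm w - harm a) := by
  induction w, h using Nat.le_induction with
  | base => simp
  | succ w h ih =>
    have h1 : 0 ≤ harm w - harm a := sub_nonneg.2 (harm_mono h)
    rw [harm_succ]
    have h2 : ((w + 1 : ℕ) : ℝ) * (harm w + 1 / ((w : ℝ) + 1) - harm a)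
        = w * (harm w - harm a) + (harm w - harm a) + 1 := by
      push_cast
      field_simp
      ring
    rw [h2]
    push_cast
    linarith

theorem harm_le_one_add_log {k n : ℕ} (h : k ≤ n) :
    harm k ≤ 1 + Real.log n :=
  (harm_mono h).trans (harmonic_le_one_add_log n)

/-- In the double sum, `1/j` occurs once for each of the `j` values `a < j`. -/
theorem sum_harm_sub (m : ℕ) : ∑ a ∈ Finset.range (m + 1), (harm m - harm a) = m := by
  induction m with
  | zero => simp
  | succ m ih =>
    rw [Finset.sum_range_succ, sub_self, add_zero]
    have : ∀ a ∈ Finset.range (m + 1),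
        harm (m + 1) - harm a = (harm m - harm a) + 1 / ((m : ℝ) + 1) := fun a _ => by
      rw [harm_succ]
      ring
    rw [Finset.sum_congr rfl this, Finset.sum_add_distrib, ih]
    simp
    field_simp

/-- Discrete form of `∫₀¹ log² = 2`: by `sum_harm_sub`, passing from `m` to `m + 1` adds `(2m +
1)/(m + 1) ≤ 2`. -/
theorem sum_harm_sub_sq_le (m : ℕ) :
    ∑ a ∈ Finset.range (m + 1), (harm m - harm a) ^ 2 ≤ 2 * m := by
  induction m with
  | zero => simp
  | succ m ih =>
    rw [Finset.sum_range_succ, sub_self]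
    have : ∀ a ∈ Finset.range (m + 1), (harm (m + 1) - harm a) ^ 2 = (harm m - harm a) ^ 2 +
        2 / ((m : ℝ) + 1) * (harm m - harm a) + (1 / ((m : ℝ) + 1)) ^ 2 := fun a _ => by
      rw [harm_succ]
      ring
    rw [Finset.sum_congr rfl this, Finset.sum_add_distrib, Finset.sum_add_distrib,
      ← Finset.mul_sum, sum_harm_sub]
    have h1 : 2 / ((m : ℝ) + 1) * m + ((m : ℝ) + 1) * (1 / ((m : ℝ) + 1)) ^ 2 ≤ 2 := by
      have : (0 : ℝ) < m + 1 := by positivity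
      rw [show 2 / ((m : ℝ) + 1) * m + ((m : ℝ) + 1) * (1 / ((m : ℝ) + 1)) ^ 2
        = (2 * m + 1) / (m + 1) by field_simp, div_le_iff₀ this]
      linarith
    simp only [Finset.sum_const, Finset.card_range, nsmul_eq_mul]
    push_cast
    linarith

/-! ### Adjacency lists -/

namespace AdjLists

variable {n : ℕ} (G : AdjLists n)

theorem deg_eq_sum_mult (u : Fin n) : G.deg u = ∑ v, G.mult u v := by
  rw [deg, ← List.sum_toFinset_count_eq_length]
  exact Finset.sum_subset (Finset.subset_univ _) fun v _ hv => by
    simpa [List.count_eq_zero] using hv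

theorem mult_pos_iff {u v : Fin n} : 0 < G.mult u v ↔ v ∈ G u := List.count_pos_iff

theorem exists_isTopNeighbour {u : Fin n} (h : G u ≠ []) : ∃ v, G.IsTopNeighbour u v := by
  obtain ⟨v, hv, hmax⟩ := (G u).toFinset.exists_max_image
    -- Reversing the order of the labels makes ties go to the smaller one.
    (fun w => toLex (G.deg w, OrderDual.toDual w)) (by simpa [List.toFinset_nonempty_iff] using h)
  refine ⟨v, by simpa using hv, fun w hw => ?_⟩
  simpa [Prod.Lex.le_iff] using hmax w (by simpa using hw)

variable {G}

theorem IsTopNeighbour.deg_le {u v w : Fin n} (h : G.IsTopNeighbour u v) (hw : w ∈ G u) :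
    G.deg w ≤ G.deg v := by
  rcases h.2 w hw with h | ⟨h, -⟩ <;> omega

theorem IsTopNeighbour.unique {u v w : Fin n} (hv : G.IsTopNeighbour u v)
    (hw : G.IsTopNeighbour u w) : v = w := by
  rcases hv.2 w hw.1 with h | ⟨h, h'⟩ <;> rcases hw.2 v hv.1 with h'' | ⟨h'', h'''⟩
  · omega
  · omega
  · omega
  · exact le_antisymm h' h'''

/-- For a symmetric multigraph the mean of `d_u + d_v` is twice the sum of the squared degrees,
divided by the sum of the degrees. -/
theorem queryMean_degSum (hsymm : ∀ u v, G.mult u v = G.mult v u) :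
    G.queryMean (fun q => q.degSum) =
      2 * (∑ u, (G.deg u : ℝ) ^ 2) / ∑ u, (G.deg u : ℝ) := by
  have hcard : (Fintype.card G.Query : ℝ) = ∑ u, (G.deg u : ℝ) := by
    simp [Fintype.card_sigma, G.deg_eq_sum_mult]
  have h1 : ∑ u, ∑ v, (G.mult u v : ℝ) * G.deg u = ∑ u, (G.deg u : ℝ) ^ 2 :=
    Finset.sum_congr rfl fun u _ => by
      rw [← Finset.sum_mul, ← Nat.cast_sum, ← G.deg_eq_sum_mult, sq]
  have h2 : ∑ u, ∑ v, (G.mult u v : ℝ) * G.deg v = ∑ u, (G.deg u : ℝ) ^ 2 := by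
    rw [Finset.sum_comm, ← h1]
    exact Finset.sum_congr rfl fun u _ => Finset.sum_congr rfl fun v _ => by rw [hsymm]
  rw [queryMean, hcard]
  congr 1
  rw [Fintype.sum_sigma]
  simp_rw [Fintype.sum_sigma]
  simp only [Query.degSum, Finset.sum_const, Finset.card_univ, Fintype.card_fin, nsmul_eq_mul,
    Nat.cast_add, mul_add, Finset.sum_add_distrib]
  rw [h1, h2, two_mul]

theorem edge_mem_keptEdges_iff (D : ℝ) (q : G.Query) :
    q.edge ∈ G.keptEdges D ↔ (q.2.2 : ℕ) = 0 ∧ ((D < G.deg q.1 ∧ D < G.deg q.2.1) ∨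
      G.IsTopNeighbour q.1 q.2.1 ∨ G.IsTopNeighbour q.2.1 q.1) := by
  obtain ⟨u, v, i⟩ := q
  simp only [Query.edge, keptEdges, Set.mem_ofPred_eq, Nat.add_eq_right]
  refine and_congr_right fun _ => ⟨?_, fun h => ⟨u, v, rfl, ?_, h⟩⟩
  · rintro ⟨u', v', he, -, h⟩
    rcases Sym2.eq_iff.1 he with ⟨rfl, rfl⟩ | ⟨rfl, rfl⟩
    · exact h
    · tauto
  · exact G.mult_pos_iff.1 (i.pos)

theorem keptEdges_subset_edges (D : ℝ) : G.keptEdges D ⊆ G.edges := by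
  rintro ⟨e, i⟩ ⟨rfl : i = 1, u, v, he, hv, -⟩
  exact ⟨u, v, he, le_rfl, G.mult_pos_iff.2 hv⟩

theorem underlying_keptEdges_adj {D : ℝ} {u v : Fin n} (huv : u ≠ v) (hv : v ∈ G u)
    (h : (D < G.deg u ∧ D < G.deg v) ∨ G.IsTopNeighbour u v ∨ G.IsTopNeighbour v u) :
    (underlying (G.keptEdges D)).Adj u v :=
  ⟨huv, 1, rfl, u, v, rfl, hv, h⟩

/-- At most one edge per vertex is kept besides those between two vertices above the threshold. -/
theorem ncard_keptEdges_le {D : ℝ} (S : Finset (Fin n)) (hS : ∀ u, D < G.deg u → u ∈ S) :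
    (G.keptEdges D).ncard ≤ n + S.card ^ 2 := by
  classical
  let top : Fin n → Fin n := fun u => if h : ∃ v, G.IsTopNeighbour u v then h.choose else u
  have htop : ∀ u v, G.IsTopNeighbour u v → top u = v := fun u v h => by
    have hex : ∃ v, G.IsTopNeighbour u v := ⟨v, h⟩
    simp only [top, hex, dite_true]
    exact hex.choose_spec.unique h
  have hsub : G.keptEdges D ⊆ ((Finset.univ.image fun u => (s(u, top u), 1)) ∪
      ((S ×ˢ S).image fun p => (s(p.1, p.2), 1)) : Finset (Sym2 (Fin n) × ℕ)) := by
    rintro ⟨e, i⟩ ⟨rfl : i = 1, u, v, rfl : e = _, hv, h⟩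
    simp only [Finset.coe_union, Finset.coe_image, Set.mem_union, Set.mem_image, Finset.mem_coe,
      Finset.mem_univ, true_and, Finset.mem_product, Prod.mk.injEq, and_true, Prod.exists]
    rcases h with ⟨hu, hv⟩ | h | h
    · exact .inr ⟨u, v, ⟨hS u hu, hS v hv⟩, rfl⟩
    · exact .inl ⟨u, by rw [htop u v h]⟩
    · exact .inl ⟨v, by rw [htop v u h, Sym2.eq_swap]⟩
  calc (G.keptEdges D).ncard ≤ _ := Set.ncard_le_ncard hsub (Finset.finite_toSet _)
    _ ≤ n + S.card ^ 2 := by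
      rw [Set.ncard_coe_finset]
      refine (Finset.card_union_le _ _).trans (add_le_add ?_ ?_)
      · exact Finset.card_image_le.trans (by simp)
      · exact Finset.card_image_le.trans (by simp [sq])

end AdjLists

/-! ### Degrees in uniform attachment graphs -/

section UniformAttachment

variable {n μ : ℕ}

/-- The number of times that the vertex `a` is chosen. -/
def uaIn (ω : UAChoices n μ) (a : ℕ) : ℕ :=
  (Finset.univ.filter fun p : Fin (n - 1) × Fin μ => (ω p.1 p.2 : ℕ) = a).card

/-- The degree of the vertex that arrives as number `a`. -/
def uaDeg (ω : UAChoices n μ) (a : ℕ) : ℕ := (if 0 < a then μ else 0) + uaIn ω a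

theorem uaMult_symm (ω : UAChoices n μ) (a b : Fin n) : uaMult ω a b = uaMult ω b a := by
  simp only [uaMult, or_comm]

theorem uaMult_pos (ω : UAChoices n μ) {i : Fin (n - 1)} {j : Fin μ} {a b : Fin n}
    (ha : (i : ℕ) + 1 = a) (hb : (ω i j : ℕ) = b) : 0 < uaMult ω a b :=
  Finset.card_pos.2 ⟨(i, j), by simp [ha, hb]⟩

theorem sum_uaMult (ω : UAChoices n μ) (a : Fin n) : ∑ b, uaMult ω a b = uaDeg ω a := by
  have hout : (if 0 < (a : ℕ) then μ else 0) =
      ∑ p : Fin (n - 1) × Fin μ, if (p.1 : ℕ) + 1 = a then 1 else 0 := by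
    have hin : ∀ i : Fin (n - 1), ∑ _j : Fin μ, (if (i : ℕ) + 1 = a then 1 else 0) =
        if (i : ℕ) + 1 = a then μ else 0 := fun i => by split_ifs <;> simp
    rw [Fintype.sum_prod_type]
    refine Eq.trans ?_ (Finset.sum_congr rfl fun i _ => (hin i).symm)
    split_ifs with h
    · have hlt : (a : ℕ) - 1 < n - 1 := by omega
      rw [Finset.sum_eq_single (⟨a - 1, hlt⟩ : Fin (n - 1))]
      · rw [if_pos (by simp only; omega)]
      · intro i _ hi
        rw [if_neg]
        intro h'
        exact hi (Fin.ext (by simp only; omega))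
      · simp
    · exact (Finset.sum_eq_zero fun i _ => if_neg (by omega)).symm
  simp only [uaDeg, uaMult, uaIn, Finset.card_filter]
  rw [hout, Finset.sum_comm, ← Finset.sum_add_distrib]
  refine Finset.sum_congr rfl fun p _ => ?_
  have h1 := p.1.2
  have h2 := (ω p.1 p.2).2
  -- A choice counts for its chooser and for the chosen vertex. The two cases exclude each other
  -- since vertices choose strictly older ones.
  have e1 : ∀ b : Fin n, (if (p.1 : ℕ) + 1 = a ∧ (ω p.1 p.2 : ℕ) = b ∨
      (p.1 : ℕ) + 1 = b ∧ (ω p.1 p.2 : ℕ) = a then 1 else 0) =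
      (if (⟨ω p.1 p.2, by omega⟩ : Fin n) = b then (if (p.1 : ℕ) + 1 = a then 1 else 0) else 0) +
      (if (⟨p.1 + 1, by omega⟩ : Fin n) = b then (if (ω p.1 p.2 : ℕ) = a then 1 else 0)
        else 0) := by
    intro b
    simp only [Fin.ext_iff]
    split_ifs <;> omega
  rw [Finset.sum_congr rfl fun b _ => e1 b, Finset.sum_add_distrib]
  simp

theorem PresentsUA.mult_symm {ω : UAChoices n μ} {G : AdjLists n} (h : PresentsUA ω G)
    (u v : Fin n) : G.mult u v = G.mult v u := by
  obtain ⟨σ, hσ⟩ := h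
  have := hσ (σ.symm u) (σ.symm v)
  have := hσ (σ.symm v) (σ.symm u)
  have := uaMult_symm ω (σ.symm u) (σ.symm v)
  simp_all

theorem deg_eq_uaDeg {ω : UAChoices n μ} {G : AdjLists n} {σ : Equiv.Perm (Fin n)}
    (hσ : ∀ a b, G.mult (σ a) (σ b) = uaMult ω a b) (a : Fin n) :
    G.deg (σ a) = uaDeg ω a := by
  rw [G.deg_eq_sum_mult, ← sum_uaMult, ← Equiv.sum_comp σ]
  exact Finset.sum_congr rfl fun b _ => hσ a b

/-- The typical behaviour of the choices: in-degrees are close to their means, the eleven oldest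
vertices are pairwise adjacent, and each vertex chooses one from the older half of the vertices
present. -/
structure Regular (ω : UAChoices n μ) : Prop where
  inDeg : ∀ a : Fin n, |(uaIn ω a : ℝ) - μ * (harm (n - 1) - harm a)| ≤ μ / 50
  core : ∀ (i : Fin (n - 1)) (a : ℕ), (i : ℕ) < 10 → a ≤ i → ∃ j, (ω i j : ℕ) = a
  half : ∀ i : Fin (n - 1), ∃ j, 2 * (ω i j : ℕ) ≤ i

/-! ### Deterministic consequences of regularity -/

namespace Regular

variable {ω : UAChoices n μ}

theorem uaDeg_le (h : Regular ω) (a : Fin n) :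
    (uaDeg ω a : ℝ) ≤ μ * (51 / 50 + (harm (n - 1) - harm a)) := by
  have h1 := (abs_le.1 (h.inDeg a)).2
  have hμ : (0 : ℝ) ≤ μ := by positivity
  rw [uaDeg, Nat.cast_add]
  split_ifs
  · linarith
  · push_cast
    linarith

/-- Vertex 0 makes no choices, but its mean in-degree `μ H_{n-1}` equals the mean degree of vertex
1; hence `max a 1`. -/
theorem le_uaDeg (h : Regular ω) (a : Fin n) :
    μ * (49 / 50 + (harm (n - 1) - harm (max a 1))) ≤ (uaDeg ω a : ℝ) := by
  have h1 := (abs_le.1 (h.inDeg a)).1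
  rw [uaDeg, Nat.cast_add]
  split_ifs with ha
  · rw [max_eq_left (by omega)]
    linarith
  · have ha : (a : ℕ) = 0 := by omega
    rw [ha, harm_zero] at h1
    rw [ha, max_eq_right (by omega), harm_one]
    push_cast
    linarith

/-- After division by `μ` this compares `H_a - H_6` with `1/2` up to an error of `1/50`. At `a = 10`
the margin is about `0.021`, so the tolerance in `Regular` barely suffices. -/
theorem uaThreshold_lt_iff (h : Regular ω) (hμ : 0 < μ) (a : Fin n) :
    uaThreshold n μ < uaDeg ω a ↔ (a : ℕ) ≤ 10 := by
  have hμ' : (0 : ℝ) < μ := by exact_mod_cast hμ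
  have hD : uaThreshold n μ = μ * (harm (n - 1) - harm 6 + 1 / 2) := by
    simp only [uaThreshold, harm]
    ring
  rw [hD]
  constructor
  · intro hlt
    by_contra! ha
    have h1 := lt_of_mul_lt_mul_left (hlt.trans_le (h.uaDeg_le a)) hμ'.le
    have h2 : harm 11 ≤ harm a := harm_mono ha
    rw [harm_eleven] at h2
    linarith
  · intro ha
    refine lt_of_lt_of_le (mul_lt_mul_of_pos_left ?_ hμ') (h.le_uaDeg a)
    have h2 : harm (max a 1) ≤ harm 10 := harm_mono (by omega)
    rw [harm_ten] at h2
    linarith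

theorem sum_uaDeg_sq_le (h : Regular ω) (hn : 2 ≤ n) :
    ∑ a : Fin n, (uaDeg ω a : ℝ) ^ 2 ≤ 8 * μ ^ 2 * (n - 1 : ℕ) := by
  obtain ⟨m, rfl⟩ : ∃ m, n = m + 1 := ⟨n - 1, by omega⟩
  have hm : (1 : ℝ) ≤ m := by exact_mod_cast (by omega : 1 ≤ m)
  simp only [Nat.add_sub_cancel]
  calc ∑ a : Fin (m + 1), (uaDeg ω a : ℝ) ^ 2
      ≤ ∑ a : Fin (m + 1), (μ * (51 / 50 + (harm m - harm a))) ^ 2 :=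
        Finset.sum_le_sum fun a _ => pow_le_pow_left₀ (by positivity) (h.uaDeg_le a) 2
    _ = ∑ a ∈ Finset.range (m + 1), ((μ : ℝ) * (51 / 50 + (harm m - harm a))) ^ 2 :=
        Fin.sum_univ_eq_sum_range (fun a => ((μ : ℝ) * (51 / 50 + (harm m - harm a))) ^ 2) (m + 1)
    _ = μ ^ 2 * ((51 / 50) ^ 2 * (m + 1) + 51 / 25 * ∑ a ∈ Finset.range (m + 1), (harm m - harm a)
        + ∑ a ∈ Finset.range (m + 1), (harm m - harm a) ^ 2) := by
        rw [Finset.mul_sum, show (51 / 50 : ℝ) ^ 2 * (m + 1) =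
          ∑ a ∈ Finset.range (m + 1), (51 / 50 : ℝ) ^ 2 by simp; ring, ← Finset.sum_add_distrib,
          ← Finset.sum_add_distrib, Finset.mul_sum]
        exact Finset.sum_congr rfl fun a _ => by ring
    _ ≤ μ ^ 2 * (8 * m) := by
        rw [sum_harm_sub]
        have := sum_harm_sub_sq_le m
        gcongr
        linarith
    _ = 8 * μ ^ 2 * m := by ring

end Regular

theorem le_sum_uaDeg (ω : UAChoices n μ) :
    (μ : ℝ) * (n - 1 : ℕ) ≤ ∑ a : Fin n, (uaDeg ω a : ℝ) := by
  rcases n with _ | m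
  · simp
  calc (μ : ℝ) * ((m + 1 - 1 : ℕ) : ℝ) = ∑ a : Fin (m + 1), if 0 < (a : ℕ) then (μ : ℝ) else 0 := by
        rw [Fin.sum_univ_succ]
        simp
        ring
    _ ≤ _ := Finset.sum_le_sum fun a _ => by
        rw [uaDeg]
        split_ifs <;> push_cast <;> linarith [(Nat.cast_nonneg (uaIn ω a) : (0 : ℝ) ≤ _)]

namespace Regular

variable {ω : UAChoices n μ} {G : AdjLists n}

theorem queryMean_degSum_le (h : Regular ω) (hn : 2 ≤ n) (hμ : 0 < μ) (hG : PresentsUA ω G) :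
    G.queryMean (fun q => q.degSum) ≤ 16 * μ := by
  rw [AdjLists.queryMean_degSum hG.mult_symm]
  obtain ⟨σ, hσ⟩ := hG
  rw [← Equiv.sum_comp σ, ← Equiv.sum_comp σ (fun u => (G.deg u : ℝ))]
  simp only [deg_eq_uaDeg hσ]
  have hm : (0 : ℝ) < ((n - 1 : ℕ) : ℝ) := by exact_mod_cast (by omega : 0 < n - 1)
  have hμ' : (0 : ℝ) < μ := by exact_mod_cast hμ
  have h1 := le_sum_uaDeg ω
  have h2 := h.sum_uaDeg_sq_le hn
  rw [div_le_iff₀ (lt_of_lt_of_le (by positivity) h1)]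
  have h3 := mul_le_mul_of_nonneg_left h1 (by positivity : (0 : ℝ) ≤ 16 * μ)
  linarith

theorem deg_le (h : Regular ω) (hG : PresentsUA ω G) (u : Fin n) :
    (G.deg u : ℝ) ≤ μ * (3 + Real.log n) := by
  obtain ⟨σ, hσ⟩ := hG
  obtain ⟨a, rfl⟩ := σ.surjective u
  rw [deg_eq_uaDeg hσ]
  refine (h.uaDeg_le a).trans (mul_le_mul_of_nonneg_left ?_ (by positivity))
  have := harm_le_one_add_log (Nat.sub_le n 1)
  linarith [harm_nonneg a]

variable {σ : Equiv.Perm (Fin n)}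

theorem mem_of_le_ten (h : Regular ω) (hσ : ∀ a b, G.mult (σ a) (σ b) = uaMult ω a b)
    {a b : Fin n} (ha : (a : ℕ) ≤ 10) (hb : (b : ℕ) ≤ 10) (hab : a ≠ b) : σ b ∈ G (σ a) := by
  have key : ∀ {a b : Fin n}, (a : ℕ) ≤ 10 → b < a → 0 < uaMult ω a b := by
    intro a b ha hba
    rw [Fin.lt_def] at hba
    obtain ⟨j, hj⟩ := h.core ⟨a - 1, by omega⟩ b (by simp only; omega) (by simp only; omega)
    exact uaMult_pos ω (by simp only; omega) hj
  rw [← AdjLists.mult_pos_iff, hσ]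
  rcases lt_or_gt_of_ne hab with h' | h'
  · rw [uaMult_symm]
    exact key hb h'
  · exact key ha h'

theorem exists_mem_half (h : Regular ω) (hσ : ∀ a b, G.mult (σ a) (σ b) = uaMult ω a b)
    {k : Fin n} (hk : 0 < (k : ℕ)) : ∃ a : Fin n, 2 * (a : ℕ) < k ∧ σ a ∈ G (σ k) := by
  obtain ⟨j, hj⟩ := h.half ⟨k - 1, by omega⟩
  simp only at hj
  refine ⟨⟨ω ⟨k - 1, by omega⟩ j, by omega⟩, by simp only; omega, ?_⟩
  rw [← AdjLists.mult_pos_iff, hσ]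
  exact uaMult_pos ω (j := j) (by simp only; omega) rfl

/-- The highest-degree neighbour of a young vertex is older by a constant factor. -/
theorem three_mul_top_le (h : Regular ω) (hμ : 0 < μ)
    (hσ : ∀ a b, G.mult (σ a) (σ b) = uaMult ω a b) {k w : Fin n} (hk : 11 ≤ (k : ℕ))
    (hw : G.IsTopNeighbour (σ k) (σ w)) : 3 * (w : ℕ) ≤ 2 * k := by
  -- If `3w > 2k`, the neighbour `a < k/2` has `4a < 3w`. But `w` has at least the degree of `a`,
  -- which forces `H_w - H_a ≤ 2/50` and so `a ≥ (24/25) w` (with `max a 1` for `a`).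
  by_contra! hlt
  obtain ⟨a, ha, hmem⟩ := h.exists_mem_half hσ (k := k) (by omega)
  have hμ' : (0 : ℝ) < μ := by exact_mod_cast hμ
  have h1 : (uaDeg ω a : ℝ) ≤ uaDeg ω w := by
    rw [← deg_eq_uaDeg hσ, ← deg_eq_uaDeg hσ]
    exact_mod_cast hw.deg_le hmem
  have h2 := le_of_mul_le_mul_left ((h.le_uaDeg a).trans (h1.trans (h.uaDeg_le w))) hμ'
  have h3 : max (a : ℕ) 1 ≤ w := by omega
  have h4 := sub_le_mul_harm_sub h3
  have hw0 : (0 : ℝ) < (w : ℕ) := by exact_mod_cast (by omega : 0 < (w : ℕ))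
  have h5 : ((w : ℕ) : ℝ) * (harm w - harm (max (a : ℕ) 1)) ≤ (w : ℕ) * (1 / 25) :=
    mul_le_mul_of_nonneg_left (by linarith) hw0.le
  have h6 : (4 : ℝ) * (max (a : ℕ) 1 : ℕ) ≤ 3 * (w : ℕ) := by
    exact_mod_cast (by omega : 4 * max (a : ℕ) 1 ≤ 3 * w)
  linarith

/-- Vertex `a` has another of the eleven oldest as a neighbour, and that one is above the threshold
while `b` is not. -/
theorem not_isTopNeighbour (h : Regular ω) (hμ : 0 < μ)
    (hσ : ∀ a b, G.mult (σ a) (σ b) = uaMult ω a b) {a b : Fin n} (ha : (a : ℕ) ≤ 10)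
    (hb : 11 ≤ (b : ℕ)) : ¬ G.IsTopNeighbour (σ a) (σ b) := by
  intro htop
  obtain ⟨c, hc, hac⟩ : ∃ c : Fin n, (c : ℕ) ≤ 10 ∧ a ≠ c := by
    by_cases h0 : (a : ℕ) = 0
    · exact ⟨⟨1, by omega⟩, by simp, by simp [Fin.ext_iff, h0]⟩
    · exact ⟨⟨0, by omega⟩, by simp, by simpa [Fin.ext_iff] using h0⟩
  have h1 := htop.deg_le (h.mem_of_le_ten hσ ha hc hac)
  rw [deg_eq_uaDeg hσ, deg_eq_uaDeg hσ] at h1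
  have h2 := (h.uaThreshold_lt_iff hμ c).2 hc
  have h3 := (h.uaThreshold_lt_iff hμ b).1 (h2.trans_le (by exact_mod_cast h1))
  omega

/-- Highest-degree neighbours are followed until the index is at most 10. The base `4/3`, smaller
than the shrinking factor `3/2`, leaves room for the `+ 1`. -/
theorem exists_walk_to_core (h : Regular ω) (hμ : 0 < μ)
    (hσ : ∀ a b, G.mult (σ a) (σ b) = uaMult ω a b) (k : ℕ) (hk : k < n) :
    ∃ c : Fin n, (c : ℕ) ≤ 10 ∧
      ∃ p : (AdjLists.underlying (G.keptEdges (uaThreshold n μ))).Walk (σ ⟨k, hk⟩) (σ c),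
        (4 / 3 : ℝ) ^ p.length ≤ k + 1 := by
  induction k using Nat.strong_induction_on with
  | _ k ih =>
    by_cases hk10 : k ≤ 10
    · exact ⟨⟨k, hk⟩, hk10, .nil, by simp⟩
    · obtain ⟨a, -, ha⟩ := h.exists_mem_half hσ (k := ⟨k, hk⟩) (by simp only; omega)
      obtain ⟨v, hv⟩ := G.exists_isTopNeighbour (List.ne_nil_of_mem ha)
      obtain ⟨w, rfl⟩ := σ.surjective v
      have hw := h.three_mul_top_le hμ hσ (by simp only; omega) hv
      simp only at hw
      obtain ⟨c, hc, p, hp⟩ := ih w (by omega) w.2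
      have hadj : (AdjLists.underlying (G.keptEdges (uaThreshold n μ))).Adj (σ ⟨k, hk⟩)
          (σ ⟨w, w.2⟩) := by
        refine AdjLists.underlying_keptEdges_adj (fun he => ?_) hv.1 (.inr (.inl hv))
        have := congrArg Fin.val (σ.injective he)
        simp only at this
        omega
      refine ⟨c, hc, .cons hadj p, ?_⟩
      rw [SimpleGraph.Walk.length_cons, pow_succ]
      have h1 : (3 : ℝ) * (w : ℕ) ≤ 2 * k := by exact_mod_cast hw
      have h2 : (3 : ℝ) ≤ k := by exact_mod_cast (by omega : 3 ≤ k)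
      linarith

theorem exists_walk_length_le (h : Regular ω) (hμ : 0 < μ) (hG : PresentsUA ω G) (u v : Fin n) :
    ∃ p : (AdjLists.underlying (G.keptEdges (uaThreshold n μ))).Walk u v,
      (p.length : ℝ) ≤ 8 * Real.log n + 1 := by
  obtain ⟨σ, hσ⟩ := hG
  have key : ∀ u : Fin n, ∃ c : Fin n, (c : ℕ) ≤ 10 ∧
      ∃ p : (AdjLists.underlying (G.keptEdges (uaThreshold n μ))).Walk u (σ c),
        (p.length : ℝ) ≤ 4 * Real.log n := by
    intro u
    obtain ⟨k, rfl⟩ := σ.surjective u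
    obtain ⟨c, hc, p, hp⟩ := h.exists_walk_to_core hμ hσ k k.2
    refine ⟨c, hc, p, ?_⟩
    have h1 : (4 / 3 : ℝ) ^ p.length ≤ n := hp.trans (by exact_mod_cast k.2)
    have h2 := Real.log_le_log (by positivity) h1
    rw [Real.log_pow] at h2
    -- `log (4/3) ≥ 1 - 3/4 = 1/4`, hence the factor 4.
    have h3 := Real.one_sub_inv_le_log_of_pos (by norm_num : (0 : ℝ) < 4 / 3)
    have h4 := mul_le_mul_of_nonneg_left h3 (Nat.cast_nonneg (α := ℝ) p.length)
    norm_num at h4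
    linarith
  obtain ⟨a, ha, p, hp⟩ := key u
  obtain ⟨b, hb, q, hq⟩ := key v
  by_cases hab : a = b
  · subst hab
    refine ⟨p.append q.reverse, ?_⟩
    rw [SimpleGraph.Walk.length_append, SimpleGraph.Walk.length_reverse, Nat.cast_add]
    linarith
  · have hadj : (AdjLists.underlying (G.keptEdges (uaThreshold n μ))).Adj (σ a) (σ b) := by
      refine AdjLists.underlying_keptEdges_adj (σ.injective.ne hab)
        (h.mem_of_le_ten hσ ha hb hab) (.inl ?_)
      rw [deg_eq_uaDeg hσ, deg_eq_uaDeg hσ]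
      exact ⟨(h.uaThreshold_lt_iff hμ a).2 ha, (h.uaThreshold_lt_iff hμ b).2 hb⟩
    refine ⟨p.append (.cons hadj q.reverse), ?_⟩
    rw [SimpleGraph.Walk.length_append, SimpleGraph.Walk.length_cons,
      SimpleGraph.Walk.length_reverse]
    push_cast
    linarith

/-- The diameter bound suffices, since distinct vertices have distance at least 1 in `G`. -/
theorem isSpanner (h : Regular ω) (hμ : 0 < μ) (hG : PresentsUA ω G) {k : ℝ}
    (hk : 8 * Real.log n + 1 ≤ k) : G.IsSpanner (G.keptEdges (uaThreshold n μ)) k := by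
  refine ⟨AdjLists.keptEdges_subset_edges _, fun u v huv => ?_⟩
  obtain ⟨p, hp⟩ := h.exists_walk_length_le hμ hG u v
  refine ⟨⟨p⟩, ?_⟩
  by_cases hne : u = v
  · simp [hne]
  · have h1 : (1 : ℝ) ≤ (AdjLists.underlying G.edges).dist u v := by
      exact_mod_cast huv.pos_dist_of_ne hne
    have h2 : ((AdjLists.underlying (G.keptEdges (uaThreshold n μ))).dist u v : ℝ) ≤ p.length := by
      exact_mod_cast SimpleGraph.dist_le p
    have h3 : (0 : ℝ) ≤ k := (Nat.cast_nonneg _).trans (hp.trans hk)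
    nlinarith

theorem ncard_keptEdges_le (h : Regular ω) (hμ : 0 < μ) (hG : PresentsUA ω G) :
    (G.keptEdges (uaThreshold n μ)).ncard ≤ n + 121 := by
  obtain ⟨σ, hσ⟩ := hG
  refine (AdjLists.ncard_keptEdges_le
    ((Finset.univ.filter fun a : Fin n => (a : ℕ) ≤ 10).map σ.toEmbedding) fun u hu => ?_).trans ?_
  · obtain ⟨a, rfl⟩ := σ.surjective u
    rw [deg_eq_uaDeg hσ, h.uaThreshold_lt_iff hμ] at hu
    simpa using hu
  · rw [Finset.card_map]
    have : (Finset.univ.filter fun a : Fin n => (a : ℕ) ≤ 10).card ≤ 11 := by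
      rw [← Finset.card_map Fin.valEmbedding]
      refine (Finset.card_le_card (t := Finset.range 11) fun x hx => ?_).trans (by simp)
      simp only [Finset.mem_map, Finset.mem_filter, Finset.mem_univ, true_and,
        Fin.valEmbedding_apply] at hx
      obtain ⟨a, ha, rfl⟩ := hx
      simp only [Finset.mem_range]
      omega
    have := Nat.pow_le_pow_left this 2
    omega

/-- On regular outcomes it suffices to search the lists of vertices that are not above the
threshold. -/
theorem kept_iff (h : Regular ω) (hμ : 0 < μ) (hG : PresentsUA ω G) (u v : Fin n) :
    ((uaThreshold n μ < G.deg u ∧ uaThreshold n μ < G.deg v) ∨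
      (G.deg u ≤ uaThreshold n μ ∧ G.IsTopNeighbour u v) ∨
      (G.deg v ≤ uaThreshold n μ ∧ G.IsTopNeighbour v u)) ↔
    ((uaThreshold n μ < G.deg u ∧ uaThreshold n μ < G.deg v) ∨
      G.IsTopNeighbour u v ∨ G.IsTopNeighbour v u) := by
  obtain ⟨σ, hσ⟩ := hG
  have key : ∀ u v : Fin n, G.IsTopNeighbour u v → uaThreshold n μ < G.deg u →
      uaThreshold n μ < G.deg v := by
    intro u v htop hu
    obtain ⟨a, rfl⟩ := σ.surjective u
    obtain ⟨b, rfl⟩ := σ.surjective v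
    rw [deg_eq_uaDeg hσ, h.uaThreshold_lt_iff hμ] at hu ⊢
    by_contra! hb
    exact h.not_isTopNeighbour hμ hσ hu hb htop
  have h1 := key u v
  have h2 := key v u
  rcases le_or_gt (G.deg u : ℝ) (uaThreshold n μ) with h3 | h3 <;>
  rcases le_or_gt (G.deg v : ℝ) (uaThreshold n μ) with h4 | h4 <;>
  simp only [h3, h4, h3.not_gt, h4.not_gt, not_le.2, true_and, false_and, and_false, and_true,
    false_or, or_false, true_or] at h1 h2 ⊢ <;> tauto

end Regular

end UniformAttachment

/-! ### Regularity holds with high probability -/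

section Probability

variable {n μ : ℕ}

instance (n μ : ℕ) : IsProbabilityMeasure (uaMeasure n μ) := by
  unfold uaMeasure
  infer_instance

/-- Independence in the form used for both the moment generating functions and the avoidance events.
-/
theorem integral_uaMeasure_prod (f : Fin (n - 1) → ℕ → ℝ) :
    ∫ ω, ∏ i, ∏ j, f i (ω i j) ∂(uaMeasure n μ) =
      ∏ i : Fin (n - 1), ((∑ x ∈ Finset.range ((i : ℕ) + 1), f i x) / ((i : ℕ) + 1)) ^ μ := by
  rw [uaMeasure, integral_fintype_prod_eq_prod
    (f := fun (i : Fin (n - 1)) (y : Fin μ → Fin ((i : ℕ) + 1)) => ∏ j, f i (y j))]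
  refine Finset.prod_congr rfl fun i _ => ?_
  rw [integral_fintype_prod_eq_prod (f := fun _ (x : Fin ((i : ℕ) + 1)) => f i x),
    Finset.prod_const, Finset.card_univ, Fintype.card_fin, PMF.integral_eq_sum]
  simp only [PMF.uniformOfFintype_apply, Fintype.card_fin, ENNReal.toReal_inv,
    ENNReal.toReal_natCast, smul_eq_mul]
  rw [← Finset.mul_sum, Fin.sum_univ_eq_sum_range (fun x => f i x), inv_mul_eq_div]
  push_cast
  rfl

theorem sum_one_div_eq_harm_sub {a m : ℕ} (h : a ≤ m) :
    ∑ i ∈ Finset.range m, (if a ≤ i then 1 / ((i : ℝ) + 1) else 0) = harm m - harm a := by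
  induction m, h using Nat.le_induction with
  | base =>
    rw [sub_self]
    exact Finset.sum_eq_zero fun i hi => if_neg (by simpa using hi)
  | succ m h ih =>
    rw [Finset.sum_range_succ, ih, harm_succ, if_pos h]
    ring

theorem integral_exp_uaIn_le (t : ℝ) {a : ℕ} (ha : a < n) :
    ∫ ω : UAChoices n μ, Real.exp (t * uaIn ω a) ∂(uaMeasure n μ) ≤
      Real.exp (μ * (harm (n - 1) - harm a) * (Real.exp t - 1)) := by
  have h1 : ∀ ω : UAChoices n μ, Real.exp (t * uaIn ω a) =
      ∏ i, ∏ j, (if (ω i j : ℕ) = a then Real.exp t else 1) := by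
    intro ω
    rw [← Fintype.prod_prod_type' (fun i j => if (ω i j : ℕ) = a then Real.exp t else 1),
      Finset.prod_ite, Finset.prod_const, Finset.prod_const_one, mul_one, ← Real.exp_nat_mul,
      mul_comm]
    rfl
  simp_rw [h1]
  rw [integral_uaMeasure_prod fun _ x => if x = a then Real.exp t else 1]
  have h2 : ∀ i : Fin (n - 1), ((∑ x ∈ Finset.range ((i : ℕ) + 1),
      if x = a then Real.exp t else 1) / ((i : ℕ) + 1)) ^ μ ≤
      Real.exp (μ * ((if a ≤ (i : ℕ) then 1 / (((i : ℕ) : ℝ) + 1) else 0) *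
        (Real.exp t - 1))) := by
    intro i
    rw [Real.exp_nat_mul]
    refine pow_le_pow_left₀ (div_nonneg (Finset.sum_nonneg fun x _ => ?_) (by positivity)) ?_ μ
    · split_ifs <;> positivity
    · have e : ∑ x ∈ Finset.range ((i : ℕ) + 1), (if x = a then Real.exp t else 1) =
          ((i : ℕ) + 1) + (if a ≤ (i : ℕ) then Real.exp t - 1 else 0) := by
        have : ∀ x ∈ Finset.range ((i : ℕ) + 1), (if x = a then Real.exp t else 1) =
            1 + if a = x then Real.exp t - 1 else 0 := fun x _ => by
          rcases eq_or_ne x a with h | h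
          · simp [h]
          · simp [h, h.symm]
        rw [Finset.sum_congr rfl this, Finset.sum_add_distrib, Finset.sum_ite_eq]
        simp
      rw [e]
      refine le_trans (le_of_eq ?_) (Real.add_one_le_exp _)
      have : (((i : ℕ) : ℝ) + 1) ≠ 0 := by positivity
      split_ifs <;> field_simp <;> ring
  refine (Finset.prod_le_prod (fun i _ => ?_) fun i _ => h2 i).trans (le_of_eq ?_)
  · exact pow_nonneg (div_nonneg (Finset.sum_nonneg fun x _ => by split_ifs <;> positivity)
      (by positivity)) μ
  · rw [← Real.exp_sum, ← Finset.mul_sum, ← Finset.sum_mul,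
      Fin.sum_univ_eq_sum_range (fun i => if a ≤ i then 1 / ((i : ℝ) + 1) else 0),
      sum_one_div_eq_harm_sub (by omega), mul_assoc]

/-- Chernoff's bound, using `e^t - 1 - t ≤ t²` for `|t| ≤ 1`. The sign of `t` selects the tail. -/
theorem measureReal_uaIn_le {t : ℝ} (ht : |t| ≤ 1) (s : ℝ) {a : ℕ} (ha : a < n) :
    (uaMeasure n μ).real {ω | t * (μ * (harm (n - 1) - harm a)) + s ≤ t * uaIn ω a} ≤
      Real.exp (μ * (harm (n - 1) - harm a) * t ^ 2 - s) := by
  set lam := (μ : ℝ) * (harm (n - 1) - harm a) with hlam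
  have hlam0 : 0 ≤ lam :=
    mul_nonneg (by positivity) (sub_nonneg.2 (harm_mono (by omega)))
  have h1 := mul_meas_ge_le_integral_of_nonneg (μ := uaMeasure n μ)
    (f := fun ω => Real.exp (t * uaIn ω a)) (.of_forall fun ω => (Real.exp_pos _).le)
    .of_finite (Real.exp (t * lam + s))
  simp only [Real.exp_le_exp] at h1
  have h2 := h1.trans (integral_exp_uaIn_le t ha)
  rw [← le_div_iff₀' (Real.exp_pos _), ← Real.exp_sub] at h2
  refine h2.trans (Real.exp_le_exp.2 ?_)
  have h3 := (abs_le.1 (Real.abs_exp_sub_one_sub_id_le ht)).2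
  have h4 := mul_le_mul_of_nonneg_left h3 hlam0
  rw [← hlam]
  linarith

/-- All `μ` choices of a vertex avoid a tenth of the available vertices only with small
probability. -/
theorem measureReal_avoid_le (i : Fin (n - 1)) (p : ℕ → Prop) [DecidablePred p]
    (hp : (i : ℕ) + 1 ≤ 10 * ((Finset.range ((i : ℕ) + 1)).filter p).card) :
    (uaMeasure n μ).real {ω | ∀ j, ¬ p (ω i j)} ≤ Real.exp (-(μ / 10)) := by
  let f : Fin (n - 1) → ℕ → ℝ := fun k x => if k = i ∧ p x then 0 else 1
  have hf : ∀ k x, 0 ≤ f k x := fun k x => by simp only [f]; split_ifs <;> norm_num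
  have h1 := mul_meas_ge_le_integral_of_nonneg (μ := uaMeasure n μ)
    (f := fun ω => ∏ k, ∏ j, f k (ω k j))
    (.of_forall fun ω => Finset.prod_nonneg fun k _ => Finset.prod_nonneg fun j _ => hf _ _)
    .of_finite 1
  rw [one_mul, integral_uaMeasure_prod] at h1
  have hsub : {ω : UAChoices n μ | ∀ j, ¬ p (ω i j)} ⊆
      {ω | 1 ≤ ∏ k, ∏ j, f k (ω k j)} := by
    intro ω hω
    refine (Finset.prod_eq_one (M := ℝ) fun k _ => Finset.prod_eq_one fun j _ => ?_).ge
    refine if_neg ?_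
    rintro ⟨rfl, h⟩
    exact hω j h
  refine (measureReal_mono hsub).trans (h1.trans ?_)
  rw [Finset.prod_eq_single i]
  · rw [show -((μ : ℝ) / 10) = μ * (-(1 / 10)) by ring, Real.exp_nat_mul]
    refine pow_le_pow_left₀ (div_nonneg (Finset.sum_nonneg fun x _ => hf _ _) (by positivity)) ?_ μ
    have e : ∑ x ∈ Finset.range ((i : ℕ) + 1), f i x =
        ((i : ℕ) + 1) - ((Finset.range ((i : ℕ) + 1)).filter p).card := by
      rw [Finset.card_filter, Nat.cast_sum, eq_sub_iff_add_eq, ← Finset.sum_add_distrib]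
      rw [Finset.sum_congr rfl (g := fun _ => (1 : ℝ))]
      · simp
      · intro x _
        by_cases h : p x <;> simp [f, h]
    have hp' : ((i : ℕ) : ℝ) + 1 ≤ 10 * ((Finset.range ((i : ℕ) + 1)).filter p).card := by
      exact_mod_cast hp
    have h3 := Real.add_one_le_exp (-(1 / 10 : ℝ))
    rw [e, div_le_iff₀ (by positivity)]
    have h4 := mul_le_mul_of_nonneg_right h3 (by positivity : (0 : ℝ) ≤ ((i : ℕ) : ℝ) + 1)
    linarith
  · intro k _ hk
    simp only [f, hk, false_and, if_false, Finset.sum_const, Finset.card_range, nsmul_eq_mul,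
      mul_one]
    rw [Nat.cast_add, Nat.cast_one, div_self (by positivity), one_pow]
  · simp

theorem one_le_log_mul {n : ℕ} (hn : 2 ≤ n) : 1 ≤ 3 / 2 * Real.log n := by
  have h1 : Real.log 2 ≤ Real.log n := Real.log_le_log (by norm_num) (by exact_mod_cast hn)
  have := Real.log_two_gt_d9
  linarith

theorem measureReal_not_regular_le (hn : 2 ≤ n) (hμ : 150000 * Real.log n ^ 2 < μ) :
    (uaMeasure n μ).real {ω | ¬ Regular ω} ≤ 1 / n := by
  have hlog := one_le_log_mul hn
  set l := Real.log n with hl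
  have hl0 : 0 < l := by linarith
  -- `δ = n⁻⁶`, to be summed over at most `13n` bad events; `13 ≤ 2⁴ ≤ n⁴` gives the total `1/n`.
  set δ := Real.exp (-(6 * l)) with hδ
  have hδ0 : 0 ≤ δ := (Real.exp_pos _).le
  have hn0 : (0 : ℝ) < n := by positivity
  have hμ0 : (0 : ℝ) < μ := lt_of_le_of_lt (by positivity) hμ
  -- deviations of the in-degrees
  have hdev : ∀ (ε : ℝ), |ε| = 1 → ∀ a : Fin n, (uaMeasure n μ).real
      {ω | ε / (100 * (1 + l)) * (μ * (harm (n - 1) - harm a)) + 1 / (100 * (1 + l)) * (μ / 50) ≤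
        ε / (100 * (1 + l)) * uaIn ω a} ≤ δ := by
    intro ε hε a
    have h0 : 0 < 100 * (1 + l) := by positivity
    refine (measureReal_uaIn_le ?_ _ a.2).trans (Real.exp_le_exp.2 ?_)
    · rw [abs_div, hε, abs_of_pos h0, div_le_one h0]
      linarith
    · have hε2 : ε ^ 2 = 1 := by rw [← sq_abs, hε, one_pow]
      have h1 : harm (n - 1) - harm a ≤ 1 + l :=
        (sub_le_self _ (harm_nonneg a)).trans (harm_le_one_add_log (Nat.sub_le n 1))
      have h2 : (μ : ℝ) * (harm (n - 1) - harm a) * (ε / (100 * (1 + l))) ^ 2 ≤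
          μ * (1 + l) * (ε / (100 * (1 + l))) ^ 2 := by gcongr
      have h3 : (μ : ℝ) * (1 + l) * (ε / (100 * (1 + l))) ^ 2 - 1 / (100 * (1 + l)) * (μ / 50) =
          -(μ / (10000 * (1 + l))) := by
        rw [div_pow, hε2]
        field_simp
        ring
      -- The source of `log²` and of `150000 = 6 · 10000 · 5/2`: `l ≥ 2/3` gives `1 + l ≤ (5/2) l`.
      have h4 : 6 * l ≤ μ / (10000 * (1 + l)) := by
        rw [le_div_iff₀ (by positivity)]
        nlinarith
      linarith
  have havoid : Real.exp (-((μ : ℝ) / 10)) ≤ δ := by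
    refine Real.exp_le_exp.2 ?_
    nlinarith
  have hcore : ∀ q : Fin (n - 1) × Fin 10, (uaMeasure n μ).real
      {ω | (q.2 : ℕ) ≤ q.1 ∧ (q.1 : ℕ) < 10 ∧ ∀ j, ¬ (ω q.1 j : ℕ) = q.2} ≤ δ := by
    rintro ⟨i, a⟩
    by_cases h : (a : ℕ) ≤ i ∧ (i : ℕ) < 10
    · refine (measureReal_mono (fun ω hω => hω.2.2)).trans
        ((measureReal_avoid_le i (fun x => x = a) ?_).trans havoid)
      rw [Finset.filter_eq', if_pos (by simp; omega), Finset.card_singleton]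
      omega
    · rw [show {ω : UAChoices n μ | (a : ℕ) ≤ i ∧ (i : ℕ) < 10 ∧ ∀ j, ¬ (ω i j : ℕ) = a} = ∅ from
        Set.eq_empty_of_forall_notMem fun ω hω => h ⟨hω.1, hω.2.1⟩, measureReal_empty]
      exact hδ0
  have hhalf : ∀ i : Fin (n - 1), (uaMeasure n μ).real {ω | ∀ j, ¬ 2 * (ω i j : ℕ) ≤ i} ≤ δ := by
    intro i
    refine (measureReal_avoid_le i (fun x => 2 * x ≤ i) ?_).trans havoid
    have hsub : Finset.range ((i : ℕ) / 2 + 1) ⊆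
        (Finset.range ((i : ℕ) + 1)).filter fun x => 2 * x ≤ i := fun x hx => by
      simp only [Finset.mem_range, Finset.mem_filter] at hx ⊢
      omega
    have := Finset.card_le_card hsub
    rw [Finset.card_range] at this
    omega
  have hsub : {ω : UAChoices n μ | ¬ Regular ω} ⊆
      ((⋃ a : Fin n, {ω | 1 / (100 * (1 + l)) * (μ * (harm (n - 1) - harm a)) +
          1 / (100 * (1 + l)) * (μ / 50) ≤ 1 / (100 * (1 + l)) * uaIn ω a}) ∪
        (⋃ a : Fin n, {ω | -1 / (100 * (1 + l)) * (μ * (harm (n - 1) - harm a)) +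
          1 / (100 * (1 + l)) * (μ / 50) ≤ -1 / (100 * (1 + l)) * uaIn ω a})) ∪
      ((⋃ q : Fin (n - 1) × Fin 10,
        {ω | (q.2 : ℕ) ≤ q.1 ∧ (q.1 : ℕ) < 10 ∧ ∀ j, ¬ (ω q.1 j : ℕ) = q.2}) ∪
        (⋃ i : Fin (n - 1), {ω | ∀ j, ¬ 2 * (ω i j : ℕ) ≤ i})) := by
    intro ω hω
    by_contra hc
    simp only [Set.mem_union, Set.mem_iUnion, Set.mem_ofPred_eq, not_or, not_exists, not_and,
      not_forall, not_not, not_le] at hc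
    obtain ⟨⟨h1, h2⟩, h3, h4⟩ := hc
    have h0 : 0 < 1 / (100 * (1 + l)) := by positivity
    refine hω ⟨fun a => abs_le.2 ⟨?_, ?_⟩, fun i a hi ha => ?_, fun i => (h4 i).imp fun j hj => not_lt.1 hj⟩
    · have := h2 a
      rw [neg_div] at this
      refine le_of_mul_le_mul_left ?_ h0
      linarith
    · have := h1 a
      refine le_of_mul_le_mul_left ?_ h0
      linarith
    · exact h3 (i, ⟨a, by omega⟩) ha hi
  have hunion : ∀ {ι : Type} [Fintype ι] (A : ι → Set (UAChoices n μ)),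
      (∀ i, (uaMeasure n μ).real (A i) ≤ δ) →
      (uaMeasure n μ).real (⋃ i, A i) ≤ Fintype.card ι * δ := fun A hA =>
    (measureReal_iUnion_fintype_le A).trans ((Finset.sum_le_sum fun i _ => hA i).trans
      (by simp))
  have htotal : (uaMeasure n μ).real {ω | ¬ Regular ω} ≤ 13 * n * δ := by
    refine (measureReal_mono hsub).trans ((measureReal_union_le _ _).trans
      ((add_le_add ((measureReal_union_le _ _).trans (add_le_add (hunion _ (hdev 1 (by simp)))
        (hunion _ (hdev (-1) (by simp))))) ((measureReal_union_le _ _).trans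
          (add_le_add (hunion _ hcore) (hunion _ hhalf)))).trans ?_))
    simp only [Fintype.card_fin, Fintype.card_prod]
    have : ((n - 1 : ℕ) : ℝ) ≤ n := by exact_mod_cast Nat.sub_le n 1
    push_cast
    nlinarith
  refine htotal.trans ?_
  have hδn : δ = 1 / (n : ℝ) ^ 6 := by
    rw [hδ, Real.exp_neg, show (6 : ℝ) * l = ((6 : ℕ) : ℝ) * l by norm_num, Real.exp_nat_mul, hl,
      Real.exp_log hn0, one_div]
  have h2 : (2 : ℝ) ≤ n := by exact_mod_cast hn
  have h16 : (2 : ℝ) ^ 4 ≤ (n : ℝ) ^ 4 := pow_le_pow_left₀ (by norm_num) h2 4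
  rw [hδn, mul_one_div, div_le_div_iff₀ (by positivity) hn0]
  nlinarith [sq_nonneg (n : ℝ)]

end Probability

/-! ### Expected running time and assembly -/

namespace AdjLists

variable {n : ℕ} {G : AdjLists n}

theorem queryMean_le_mul {f g : G.Query → ℕ} {c : ℝ} (h : ∀ q, (f q : ℝ) ≤ c * g q) :
    G.queryMean f ≤ c * G.queryMean g := by
  rw [queryMean, queryMean, ← mul_div_assoc, Finset.mul_sum]
  exact div_le_div_of_nonneg_right (Finset.sum_le_sum fun q _ => h q) (by positivity)

theorem queryMean_le {f : G.Query → ℕ} {c : ℝ} (hc : 0 ≤ c) (h : ∀ q, (f q : ℝ) ≤ c) :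
    G.queryMean f ≤ c := by
  refine div_le_of_le_mul₀ (by positivity) hc ((Finset.sum_le_sum fun q _ => h q).trans ?_)
  simp [mul_comm]

end AdjLists

section Main

variable {n μ : ℕ}

theorem PresentsUA.isEmpty_query {ω : UAChoices n μ} {G : AdjLists n} (h : PresentsUA ω G)
    (hn : n = 1) : IsEmpty G.Query := by
  subst hn
  obtain ⟨σ, hσ⟩ := h
  refine ⟨fun ⟨u, v, i⟩ => ?_⟩
  have h1 := hσ (σ.symm u) (σ.symm v)
  rw [σ.apply_symm_apply, σ.apply_symm_apply] at h1
  have h2 : uaMult ω (σ.symm u) (σ.symm v) = 0 := by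
    rw [uaMult, Finset.card_eq_zero]
    exact Finset.filter_eq_empty_iff.2 fun p => absurd p.1.2 (by omega)
  have := i.pos
  omega

theorem floor_uaThreshold_le (n μ : ℕ) :
    (⌊uaThreshold n μ⌋₊ : ℝ) ≤ μ * (Real.log n + 1 / 2) := by
  have hlog := Real.log_natCast_nonneg n
  rcases le_or_gt 0 (uaThreshold n μ) with h | h
  · refine (Nat.floor_le h).trans ?_
    have h1 := harm_le_one_add_log (Nat.sub_le n 1)
    have h2 := one_le_harm_six
    calc uaThreshold n μ = μ * (harm (n - 1) - harm 6 + 1 / 2) := by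
          simp only [uaThreshold, harm]
          ring
      _ ≤ _ := mul_le_mul_of_nonneg_left (by linarith) (by positivity)
  · rw [Nat.floor_of_nonpos h.le, Nat.cast_zero]
    positivity

/-- The answer of the algorithm to a query. -/
def Accepts {n : ℕ} (G : AdjLists n) (D : ℝ) (q : G.Query) : Prop :=
  (q.2.2 : ℕ) = 0 ∧ ((D < G.deg q.1 ∧ D < G.deg q.2.1) ∨
    (G.deg q.1 ≤ D ∧ G.IsTopNeighbour q.1 q.2.1) ∨
    (G.deg q.2.1 ≤ D ∧ G.IsTopNeighbour q.2.1 q.1))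

open Classical in
theorem exists_answers {G : AdjLists n} (hsymm : ∀ u v, G.mult u v = G.mult v u) (D : ℝ)
    (q : G.Query) : ∃ t : ℕ,
      ProbeProgram.spannerProgram.Answers G μ ⌊D⌋₊ q (decide (Accepts G D q)) t ∧
      t ≤ 18 + (if G.deg q.1 ≤ ⌊D⌋₊ then 8 * G.deg q.1 else 0) +
        (if G.deg q.2.1 ≤ ⌊D⌋₊ then 8 * G.deg q.2.1 else 0) ∧
      0 < G.deg q.1 ∧ 0 < G.deg q.2.1 := by
  have huv : q.2.1 ∈ G q.1 := G.mult_pos_iff.1 q.2.2.pos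
  have hvu : q.1 ∈ G q.2.1 := by
    rw [← G.mult_pos_iff, hsymm]
    exact q.2.2.pos
  have hdu : 0 < G.deg q.1 := List.length_pos_of_mem huv
  have hdv : 0 < G.deg q.2.1 := List.length_pos_of_mem hvu
  obtain ⟨y, t, hr, ht, h1, h0⟩ :=
    ProbeProgram.halts_spannerProgram μ ⌊D⌋₊ q huv hvu
  refine ⟨t, ⟨y, hr, ?_⟩, ht, hdu, hdv⟩
  -- For small `n` the threshold can be negative and its floor is then `0`; positivity of `d` keeps
  -- the comparisons equivalent.
  have e : ∀ {d : ℕ}, 0 < d → (⌊D⌋₊ < d ↔ D < d) := fun hd => Nat.floor_lt' hd.ne'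
  have e' : ∀ {d : ℕ}, 0 < d → (d ≤ ⌊D⌋₊ ↔ (d : ℝ) ≤ D) := fun hd => by
    rw [← not_lt, e hd, not_lt]
  rw [e hdu, e hdv, e' hdu, e' hdv] at h1 h0
  by_cases h : Accepts G D q
  · simp [h, h1 h]
  · simp [h, h0 h]

theorem cast_steps_le {t θ a b : ℕ} (h : t ≤ 18 + (if a ≤ θ then 8 * a else 0) +
    (if b ≤ θ then 8 * b else 0)) (ha : 0 < a) :
    t ≤ 26 * (a + b) ∧ t ≤ 18 + 16 * θ := by
  split_ifs at h <;> omega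

theorem Regular.accepts_iff {ω : UAChoices n μ} {G : AdjLists n} (h : Regular ω) (hμ : 0 < μ)
    (hG : PresentsUA ω G) (q : G.Query) :
    Accepts G (uaThreshold n μ) q ↔ q.edge ∈ G.keptEdges (uaThreshold n μ) := by
  rw [AdjLists.edge_mem_keptEdges_iff, Accepts, h.kept_iff hμ hG]

/-- The expected mean of a running time that is linear in `d_u + d_v` and bounded by
`μ log n`. -/
theorem integral_queryMean_le (hn : 2 ≤ n) (hμ : 150000 * Real.log n ^ 2 < μ)
    {G : UAChoices n μ → AdjLists n} (hG : ∀ ω, PresentsUA ω (G ω)) {T : ∀ ω, (G ω).Query → ℕ}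
    {A B : ℝ} (hA : 0 ≤ A) (hB : 0 ≤ B) (h1 : ∀ ω q, (T ω q : ℝ) ≤ A * (q.degSum : ℕ))
    (h2 : ∀ ω q, (T ω q : ℝ) ≤ B * (μ * Real.log n)) :
    ∫ ω, (G ω).queryMean (T ω) ∂(uaMeasure n μ) ≤ (16 * A + B) * μ := by
  classical
  have hμ0 : 0 < μ := by
    have : (0 : ℝ) < μ := lt_of_le_of_lt (by positivity) hμ
    exact_mod_cast this
  have hlog := Real.log_natCast_nonneg n
  have hn0 : (0 : ℝ) < n := by positivity
  -- The degree-sum bound is used on regular outcomes, the worst-case bound on the others.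
  have hle : ∀ ω, (G ω).queryMean (T ω) ≤
      16 * A * μ + {ω | ¬ Regular ω}.indicator (fun _ => B * (μ * Real.log n)) ω := by
    intro ω
    by_cases h : Regular ω
    · rw [Set.indicator_of_notMem (by simpa using h), add_zero]
      refine (AdjLists.queryMean_le_mul (h1 ω)).trans ?_
      have := mul_le_mul_of_nonneg_left (h.queryMean_degSum_le hn hμ0 (hG ω)) hA
      linarith
    · rw [Set.indicator_of_mem (by simpa using h)]
      have := AdjLists.queryMean_le (by positivity) (h2 ω)
      have : 0 ≤ 16 * A * μ := by positivity
      linarith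
  have hlogn : Real.log n * (1 / n) ≤ 1 := by
    rw [mul_one_div, div_le_one hn0]
    exact Real.log_le_self hn0.le
  calc ∫ ω, (G ω).queryMean (T ω) ∂(uaMeasure n μ)
      ≤ ∫ ω, (16 * A * μ + {ω | ¬ Regular ω}.indicator (fun _ => B * (μ * Real.log n)) ω)
          ∂(uaMeasure n μ) := integral_mono .of_finite .of_finite hle
    _ = 16 * A * μ + (uaMeasure n μ).real {ω | ¬ Regular ω} * (B * (μ * Real.log n)) := by
        rw [integral_add .of_finite .of_finite, integral_indicator_const _ .of_discrete]
        simp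
    _ ≤ 16 * A * μ + 1 / n * (B * (μ * Real.log n)) := by
        have := measureReal_not_regular_le hn hμ
        gcongr
    _ = 16 * A * μ + B * μ * (Real.log n * (1 / n)) := by ring
    _ ≤ 16 * A * μ + B * μ * 1 := by gcongr
    _ = (16 * A + B) * μ := by ring

end Main

theorem theorem1p9 :
    ∃ (cμ C : ℝ) (c : ℕ) (P : ProbeProgram), 0 < cμ ∧ 0 < C ∧
      ∀ n μ : ℕ, 1 ≤ n → cμ * Real.log n ^ 2 < μ →
        ∀ G : UAChoices n μ → AdjLists n, (∀ ω, PresentsUA ω (G ω)) →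
          ∃ (ans : ∀ ω, (G ω).Query → Bool) (T : ∀ ω, (G ω).Query → ℕ),
            -- on every outcome and every query the algorithm halts, with the stated running time
            (∀ ω, ∀ q : (G ω).Query,
              P.Answers (G ω) μ ⌊uaThreshold n μ⌋₊ q (ans ω q) (T ω q) ∧
              (uaThreshold n μ < min ((G ω).deg q.1) ((G ω).deg q.2.1) → (T ω q : ℝ) ≤ C) ∧
              (T ω q : ℝ) ≤ C * q.degSum ∧
              (T ω q : ℝ) ≤ C * (μ * Real.log n)) ∧
            -- expected running time for a random graph and a random query
            (∫ ω, (G ω).queryMean (T ω) ∂(uaMeasure n μ)) ≤ C * μ ∧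
            -- with high probability
            1 - 1 / (n : ℝ) ≤ (uaMeasure n μ).real {ω |
              (∀ q : (G ω).Query,
                ans ω q = true ↔ q.edge ∈ (G ω).keptEdges (uaThreshold n μ)) ∧
              (G ω).IsSpanner ((G ω).keptEdges (uaThreshold n μ)) (C * Real.log n) ∧
              ((G ω).keptEdges (uaThreshold n μ)).ncard ≤ n + c ∧
              (∀ q : (G ω).Query, (q.degSum : ℝ) ≤ C * (μ * Real.log n)) ∧
              (G ω).queryMean (fun q => q.degSum) ≤ C * μ} := by
  classical
  -- The largest demand on `C` is `16 · 26 + 55 = 471`, from the expected time; `121 = 11²`.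
  refine ⟨150000, 500, 121, ProbeProgram.spannerProgram, by norm_num, by norm_num, ?_⟩
  intro n μ hn hμ G hG
  choose T hT using fun ω (q : (G ω).Query) =>
    exists_answers (μ := μ) (hG ω).mult_symm (uaThreshold n μ) q
  refine ⟨fun ω q => decide (Accepts (G ω) (uaThreshold n μ) q), T, ?_⟩
  have hμ0 : (0 : ℝ) < μ := lt_of_le_of_lt (by positivity) hμ
  have hμ1 : 0 < μ := by exact_mod_cast hμ0
  have hlog := Real.log_natCast_nonneg n
  have hdegSum : ∀ ω (q : (G ω).Query), (T ω q : ℝ) ≤ 26 * (q.degSum : ℕ) := fun ω q => by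
    exact_mod_cast (cast_steps_le (hT ω q).2.1 (hT ω q).2.2.1).1
  have hfast : ∀ ω (q : (G ω).Query),
      uaThreshold n μ < min ((G ω).deg q.1) ((G ω).deg q.2.1) → T ω q ≤ 18 := fun ω q h => by
    obtain ⟨-, ht, hu, hv⟩ := hT ω q
    simp only [Nat.cast_min, lt_min_iff] at h
    rw [if_neg (not_le.2 ((Nat.floor_lt' hu.ne').2 h.1)),
      if_neg (not_le.2 ((Nat.floor_lt' hv.ne').2 h.2))] at ht
    exact ht
  have hloglarge : 2 ≤ n → (μ : ℝ) ≤ 3 / 2 * (μ * Real.log n) := fun h2 => by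
    have := mul_le_mul_of_nonneg_left (one_le_log_mul h2) hμ0.le
    linarith
  -- `18 + 16 μ (log n + 1/2) ≤ 26 μ + 16 μ log n`, and `μ ≤ (3/2) μ log n` turns this into `39 + 16
  -- = 55`. For `n = 1` there are no queries.
  have hworst : ∀ ω (q : (G ω).Query), (T ω q : ℝ) ≤ 55 * (μ * Real.log n) := fun ω q => by
    have h2 : 2 ≤ n := by
      by_contra hlt
      exact ((hG ω).isEmpty_query (by omega)).false q
    have h3 : (T ω q : ℝ) ≤ 18 + 16 * (⌊uaThreshold n μ⌋₊ : ℝ) := by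
      exact_mod_cast (cast_steps_le (hT ω q).2.1 (hT ω q).2.2.1).2
    have h4 := floor_uaThreshold_le n μ
    have h5 : (1 : ℝ) ≤ μ := by exact_mod_cast hμ1
    have h6 := hloglarge h2
    linarith
  refine ⟨fun ω q => ⟨(hT ω q).1, fun h => ?_, ?_, ?_⟩, ?_, ?_⟩
  · have : (T ω q : ℝ) ≤ 18 := by exact_mod_cast hfast ω q h
    linarith
  · have : (0 : ℝ) ≤ (q.degSum : ℕ) := Nat.cast_nonneg _
    linarith [hdegSum ω q]
  · have : 0 ≤ μ * Real.log n := by positivity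
    linarith [hworst ω q]
  · by_cases h2 : 2 ≤ n
    · refine (integral_queryMean_le h2 hμ hG (by norm_num) (by norm_num) hdegSum hworst).trans ?_
      linarith
    · have hzero : ∀ ω, (G ω).queryMean (T ω) = 0 := fun ω => by
        have := (hG ω).isEmpty_query (by omega)
        simp [AdjLists.queryMean]
      simp only [hzero, integral_zero]
      positivity
  · by_cases h2 : 2 ≤ n
    · have hbad := measureReal_not_regular_le h2 hμ
      have hcompl := probReal_add_probReal_compl (μ := uaMeasure n μ)
        (s := {ω | Regular ω}) .of_discrete
      have hgood : 1 - 1 / (n : ℝ) ≤ (uaMeasure n μ).real {ω | Regular ω} := by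
        rw [Set.compl_ofPred] at hcompl
        linarith
      refine hgood.trans (measureReal_mono fun ω (h : Regular ω) => ⟨fun q => ?_, ?_, ?_, ?_, ?_⟩)
      · rw [decide_eq_true_iff]
        exact h.accepts_iff hμ1 (hG ω) q
      · exact h.isSpanner hμ1 (hG ω) (by linarith [one_le_log_mul h2])
      · exact h.ncard_keptEdges_le hμ1 (hG ω)
      · intro q
        have h3 := h.deg_le (hG ω) q.1
        have h4 := h.deg_le (hG ω) q.2.1
        have h5 := hloglarge h2
        rw [AdjLists.Query.degSum, Nat.cast_add]
        linarith
      · exact (h.queryMean_degSum_le h2 hμ1 (hG ω)).trans (by linarith)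
    · obtain rfl : n = 1 := by omega
      simp
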